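/- Let $v\in(0,1)$ and consider, for $(\Sigma_+,\Sigma_-,N_2,N_3)\in\mathbb{R}^4$ and $\Sigma^2:=\Sigma_+^2+\Sigma_-^2$, the system $$\Sigma_+'=2(1-\Sigma^2)(1+2v\Sigma_+),\qquad \Sigma_-'=4v(1-\Sigma^2)\Sigma_-+2\sqrt3\,(N_2^2-N_3^2),$$ $$N_2'=-2(2v\Sigma^2+\Sigma_++\sqrt3\,\Sigma_-)N_2,\qquad N_3'=-2(2v\Sigma^2+\Sigma_+-\sqrt3\,\Sigma_-)N_3,$$ with the constraint $1-\Sigma^2-(N_2-N_3)^2=0$ (the vacuum $\lambda$-$R$ models with $N_1=0$; the derivative is with respect to the time $\tau_-$, directed toward the initial singularity). The Bianchi type $\mathrm{VII}_0$ state space is the part $N_2>0$, $N_3>0$ of the constraint set. Its boundary is $\mathrm{II}_2\cup\mathrm{II}_3\cup\mathrm{K}^{\circ}$, where $\mathrm{II}_2$ is the part $N_2>0,\ N_3=0$ of the constraint set, $\mathrm{II}_3$ is the part $N_2=0,\ N_3>0$, and $\mathrm{K}^{\circ}$ is the Kasner circle $\Sigma^2=1$, $N_2=N_3=0$, which consists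 of fixed points. Put $$A_2:=\{p\in\mathrm{K}^{\circ}:\Sigma_++\sqrt3\,\Sigma_-\le-2v\},\qquad A_3:=\{p\in\mathrm{K}^{\circ}:\Sigma_+-\sqrt3\,\Sigma_-\le-2v\},\qquad S_{\mathrm{VII}_0}:=\mathrm{K}^{\circ}\setminus\mathrm{int}(A_2\cup A_3),$$ the interior being taken in $\mathrm{K}^{\circ}$, and $\mathrm{LRS}^-:=\{\Sigma_+=-1,\ \Sigma_-=0,\ N_2=N_3=:N>0\}$. Through every point of the type $\mathrm{VII}_0$ state space there is a solution defined for all $\tau_-\in\mathbb{R}$. The $\omega$-limit set (as $\tau_-\to\infty$) of every type $\mathrm{VII}_0$ orbit is non-empty and contained in $S_{\mathrm{VII}_0}$, apart from the following three exceptions. (i) If $v<1/2$, the set $\mathrm{LRS}^-$ is a single orbit, and $\lim_{\tau_-\to\infty}N=\infty$ along it. (ii) If $v=1/2$, the set $\mathrm{LRS}^-$ is a line of fixed points, $N_2=N_3=\mathrm{constant}$. (iii) If $v>1/2$, the part $\Sigma_+=-1/(2v)$ of the type $\mathrm{VII}_0$ state space is a non-empty invariant submanifold of codimension one. The part $\Sigma_+=-1/(2v)$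 of the boundary $\mathrm{II}_2\cup\mathrm{II}_3\cup\mathrm{K}^{\circ}$ is a heteroclinic cycle with period 2, that is, it consists of two distinct fixed points $p,q\in\mathrm{K}^{\circ}$, an orbit in $\mathrm{II}_2$ from $p$ to $q$ and an orbit in $\mathrm{II}_3$ from $q$ to $p$. The $\omega$-limit set of every type $\mathrm{VII}_0$ orbit with $\Sigma_+=-1/(2v)$ is this heteroclinic cycle. -/

import Mathlib

open Set Filter Topology
open scoped ContDiff

noncomputable section

namespace LambdaR

/-- Points `(Σ₊, Σ₋, N₂, N₃)`; the variable `N₁` vanishes identically. -/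
abbrev State : Type := Fin 4 → ℝ

/-- The shear variable `Σ₊`. -/
def sigP (p : State) : ℝ := p 0

/-- The shear variable `Σ₋`. -/
def sigM (p : State) : ℝ := p 1

/-- The curvature variable `N₂`. -/
def n2 (p : State) : ℝ := p 2

/-- The curvature variable `N₃`. -/
def n3 (p : State) : ℝ := p 3

/-- `Σ² = Σ₊² + Σ₋²`. -/
def sigSq (p : State) : ℝ := sigP p ^ 2 + sigM p ^ 2

/-- `Σ₂ = Σ₊ + √3 Σ₋`. -/
def sig2 (p : State) : ℝ := sigP p + √3 * sigM p

/-- `Σ₃ = Σ₊ - √3 Σ₋`. -/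
def sig3 (p : State) : ℝ := sigP p - √3 * sigM p

/-- The right-hand side of the evolution equations (time `τ₋`, so that `τ₋ → ∞` is the approach to
the initial singularity). -/
def vectorField (v : ℝ) (p : State) : State :=
  ![2 * (1 - sigSq p) * (1 + 2 * v * sigP p),
    4 * v * (1 - sigSq p) * sigM p + 2 * √3 * (n2 p ^ 2 - n3 p ^ 2),
    -2 * (2 * v * sigSq p + sig2 p) * n2 p,
    -2 * (2 * v * sigSq p + sig3 p) * n3 p]

/-- The function whose vanishing is the Hamiltonian constraint. -/
def constraint (p : State) : ℝ := 1 - sigSq p - (n2 p - n3 p) ^ 2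

/-- A solution, defined for all times, of the evolution equations. -/
def IsSolution (v : ℝ) (γ : ℝ → State) : Prop :=
  ∀ t : ℝ, HasDerivAt γ (vectorField v (γ t)) t

/-- A set is invariant if every solution which starts in it stays in it, in both time directions. -/
def IsInvariant (v : ℝ) (M : Set State) : Prop :=
  ∀ γ : ℝ → State, IsSolution v γ → γ 0 ∈ M → ∀ t : ℝ, γ t ∈ M

/-- The `ω`-limit set of a curve: Mathlib's `ω`-limit, for evaluation of curves at time `t`. -/
def omegaLimitSet (γ : ℝ → State) : Set State :=
  omegaLimit atTop (fun (t : ℝ) (δ : ℝ → State) => δ t) {γ}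

theorem mem_omegaLimitSet_iff (γ : ℝ → State) (q : State) :
    q ∈ omegaLimitSet γ ↔ MapClusterPt q atTop γ :=
  mem_omegaLimit_singleton_iff_mapClusterPt _ _ _ _

/-- The three-dimensional Bianchi type `VII₀` state space. -/
def typeVII0 : Set State := {p | constraint p = 0 ∧ 0 < n2 p ∧ 0 < n3 p}

/-- The Bianchi type `II₂` boundary set. -/
def typeII2 : Set State := {p | constraint p = 0 ∧ 0 < n2 p ∧ n3 p = 0}

/-- The Bianchi type `II₃` boundary set. -/
def typeII3 : Set State := {p | constraint p = 0 ∧ n2 p = 0 ∧ 0 < n3 p}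

/-- The Kasner circle (Bianchi type `I`). -/
def kasnerCircle : Set State := {p | sigSq p = 1 ∧ n2 p = 0 ∧ n3 p = 0}

/-- The closed Kasner arc `A₂`. -/
def arc2 (v : ℝ) : Set State := {p ∈ kasnerCircle | sig2 p ≤ -2 * v}

/-- The closed Kasner arc `A₃`. -/
def arc3 (v : ℝ) : Set State := {p ∈ kasnerCircle | sig3 p ≤ -2 * v}

/-- The stable set: the Kasner circle minus the interior, relative to the Kasner circle,
of `A₂ ∪ A₃`. -/
def stableSet (v : ℝ) : Set State :=
  kasnerCircle \ {p | arc2 v ∪ arc3 v ∈ 𝓝[kasnerCircle] p}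

/-- The locally rotationally symmetric set `LRS⁻`. -/
def lrsMinus : Set State := {p | sigP p = -1 ∧ sigM p = 0 ∧ n2 p = n3 p ∧ 0 < n2 p}

/-- The part `Σ₊ = -1/(2v)` of the type `VII₀` state space. -/
def separatrix (v : ℝ) : Set State := {p ∈ typeVII0 | sigP p = -1 / (2 * v)}

/-- The part `Σ₊ = -1/(2v)` of the boundary `II₂ ∪ II₃ ∪ K` of the type `VII₀` state space. -/
def separatrixBoundary (v : ℝ) : Set State :=
  {p ∈ typeII2 ∪ typeII3 ∪ kasnerCircle | sigP p = -1 / (2 * v)}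

/-- `M` is a smooth submanifold of codimension one of the type `VII₀` state space: locally it is
cut out of this state space by one smooth function whose differential is independent of that of
the constraint. -/
def IsCodimOne (M : Set State) : Prop :=
  M ⊆ typeVII0 ∧ ∀ p ∈ M, ∃ (U : Set State) (f : State → ℝ),
    IsOpen U ∧ p ∈ U ∧ ContDiffOn ℝ ∞ f U ∧ M ∩ U = {q ∈ typeVII0 ∩ U | f q = 0} ∧
    LinearIndependent ℝ ![fderiv ℝ constraint p, fderiv ℝ f p]

/-- `C` is a heteroclinic cycle with period 2 on the boundary: it consists of two fixed points
`p ≠ q` on the Kasner circle, a type `II₂` orbit from `p` to `q` and a type `II₃` orbit from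
`q` to `p`. -/
def IsPeriodTwoHeteroclinicCycle (v : ℝ) (C : Set State) : Prop :=
  ∃ (p q : State) (γ₂ γ₃ : ℝ → State),
    p ∈ kasnerCircle ∧ q ∈ kasnerCircle ∧ p ≠ q ∧ vectorField v p = 0 ∧ vectorField v q = 0 ∧
    IsSolution v γ₂ ∧ (∀ t, γ₂ t ∈ typeII2) ∧
    Tendsto γ₂ atBot (𝓝 p) ∧ Tendsto γ₂ atTop (𝓝 q) ∧
    IsSolution v γ₃ ∧ (∀ t, γ₃ t ∈ typeII3) ∧
    Tendsto γ₃ atBot (𝓝 q) ∧ Tendsto γ₃ atTop (𝓝 p) ∧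
    C = {p, q} ∪ range γ₂ ∪ range γ₃

end LambdaR

end

noncomputable section

namespace LambdaR

/-! ### Calculus on the half-line -/

/-! Write `x, y, a, b` for `Σ₊, Σ₋, N₂, N₃`, `c = a - b`, `s = a + b`. On the constraint set `1 - Σ²
= c²`, so `(1 + 2vx)' = 4v c² (1 + 2vx)`. As `x` is bounded, either `x = -1/(2v)` forever or `c²` is
integrable (`exists_primitive_sub_sq_le`).

In the second case `x` has a limit `X`, and the point is to show that `s² = c² + 4ab` is integrable
too; then all variables converge to a Kasner point. If `X > -2v`, the product `ab` decays
exponentially up to a bounded factor. If `X ≤ -2v`, then `|X| < 1` unless the orbit is exceptional,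
and an averaging argument with `w = y c / s` applies: for large `s` the pair `(y, c)` rotates fast,
which would make the integrals of `y²` and `c²` comparable, whereas `y² + c² → 1 - X² > 0`. The
limit lies in the stable set because a positive `N₂` or `N₃` cannot tend to zero where it grows.

On the separatrix `y² + c² = R²`. Since `v < 1` gives `4vR < 2√3`, the angle of `(y, c)` increases
at a rate at least proportional to `s`, and the same correction `w` shows `ab → 0`. The angle is
unbounded, since both Kasner points there repel `N₂` or `N₃`; so the orbit keeps winding around the
circle, whose points with `ab = 0` form the cycle. -/

theorem exists_primitive {f : ℝ → ℝ} (hf : Continuous f) :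
    ∃ F : ℝ → ℝ, F 0 = 0 ∧ ∀ t, HasDerivAt F (f t) t :=
  ⟨fun t => ∫ s in (0 : ℝ)..t, f s, by simp, fun t => hf.integral_hasStrictDerivAt 0 t |>.hasDerivAt⟩

/-- Used for quantities whose sign or zero set is invariant: `N₂`, `N₃`, the constraint and `1 +
2vΣ₊`. -/
theorem eq_mul_exp_of_hasDerivAt {f k K : ℝ → ℝ} (hf : ∀ t, HasDerivAt f (k t * f t) t)
    (hK : ∀ t, HasDerivAt K (k t) t) (hK0 : K 0 = 0) (t : ℝ) : f t = f 0 * Real.exp (K t) := by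
  have h : ∀ t, HasDerivAt (fun t => f t * Real.exp (-K t)) 0 t := fun t => by
    refine ((hf t).mul (hK t).neg.exp).congr_deriv ?_
    ring
  have := is_const_of_deriv_eq_zero (fun t => (h t).differentiableAt) (fun t => (h t).deriv) t 0
  simp only [hK0, neg_zero, Real.exp_zero, mul_one] at this
  rw [← this, mul_assoc, ← Real.exp_add]; simp

theorem monotoneOn_Ici_of_hasDerivAt {f f' : ℝ → ℝ} {T : ℝ} (hf : ∀ t, HasDerivAt f (f' t) t)
    (h : ∀ t, T ≤ t → 0 ≤ f' t) : MonotoneOn f (Ici T) :=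
  monotoneOn_of_hasDerivWithinAt_nonneg (convex_Ici T)
    (fun t _ => (hf t).continuousAt.continuousWithinAt)
    (fun t _ => (hf t).hasDerivWithinAt)
    (fun t ht => h t (by simpa using (interior_subset ht : t ∈ Ici T)))

theorem le_of_hasDerivAt_nonpos {f f' : ℝ → ℝ} {T : ℝ} (hf : ∀ t, HasDerivAt f (f' t) t)
    (h : ∀ t, T ≤ t → f' t ≤ 0) {t : ℝ} (ht : T ≤ t) : f t ≤ f T := by
  have := monotoneOn_Ici_of_hasDerivAt (T := T) (fun t => (hf t).neg)
    (fun t ht => by have := h t ht; linarith) (self_mem_Ici) ht ht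
  simpa using this

theorem exists_tendsto_of_monotoneOn {f : ℝ → ℝ} {T B : ℝ} (hf : MonotoneOn f (Ici T))
    (hB : ∀ t, T ≤ t → f t ≤ B) : ∃ l, Tendsto f atTop (𝓝 l) := by
  have hm : Monotone fun t => f (max T t) := fun s t hst =>
    hf (mem_Ici.2 (le_max_left _ _)) (mem_Ici.2 (le_max_left _ _)) (max_le_max le_rfl hst)
  refine ⟨_, (tendsto_atTop_ciSup hm ⟨B, ?_⟩).congr' ?_⟩
  · rintro _ ⟨t, rfl⟩
    exact hB _ (le_max_left _ _)
  · filter_upwards [eventually_ge_atTop T] with t ht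
    simp [ht]

theorem tendsto_atTop_of_le_hasDerivAt {f f' : ℝ → ℝ} {T δ : ℝ} (hδ : 0 < δ)
    (hf : ∀ t, HasDerivAt f (f' t) t) (h : ∀ t, T ≤ t → δ ≤ f' t) : Tendsto f atTop atTop := by
  have hm : MonotoneOn (fun t => f t - δ * t) (Ici T) := monotoneOn_Ici_of_hasDerivAt
    (fun t => (hf t).sub ((hasDerivAt_id t).const_mul δ)) (fun t ht => by have := h t ht; linarith)
  have hlin : Tendsto (fun t : ℝ => (f T - δ * T) + δ * t) atTop atTop :=
    tendsto_atTop_add_const_left _ _ (tendsto_id.const_mul_atTop hδ)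
  refine tendsto_atTop_mono' _ ?_ hlin
  filter_upwards [eventually_ge_atTop T] with t ht
  have := hm self_mem_Ici ht ht
  simp only at this
  linarith

/-- A bounded function whose derivative is bounded below by an integrable function converges. -/
theorem exists_tendsto_of_neg_le_hasDerivAt {f f' E e : ℝ → ℝ} {T K B M : ℝ} (hK : 0 ≤ K)
    (hf : ∀ t, HasDerivAt f (f' t) t) (hE : ∀ t, HasDerivAt E (e t) t)
    (h : ∀ t, T ≤ t → -(K * e t) ≤ f' t) (he : ∀ t, T ≤ t → 0 ≤ e t)
    (hB : ∀ t, T ≤ t → f t ≤ B) (hM : ∀ t, T ≤ t → E t ≤ M) : ∃ l, Tendsto f atTop (𝓝 l) := by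
  -- Both `E` and `f + K E` are nondecreasing and bounded above on the half-line; `f` is a
  -- difference of convergent functions.
  obtain ⟨l, hl⟩ := exists_tendsto_of_monotoneOn (monotoneOn_Ici_of_hasDerivAt hE he) hM
  obtain ⟨m, hm⟩ := exists_tendsto_of_monotoneOn (B := B + K * M)
    (monotoneOn_Ici_of_hasDerivAt (T := T) (fun t => (hf t).add ((hE t).const_mul K))
      (fun t ht => by have := h t ht; linarith))
    (fun t ht => add_le_add (hB t ht) (mul_le_mul_of_nonneg_left (hM t ht) hK))
  refine ⟨m - K * l, (hm.sub (hl.const_mul K)).congr fun t => ?_⟩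
  simp

/-- A nonnegative integrable function with `f' ≤ K f` tends to zero. -/
theorem tendsto_zero_of_hasDerivAt_le {f f' F : ℝ → ℝ} {T K M : ℝ} (hK : 0 ≤ K)
    (hf : ∀ t, HasDerivAt f (f' t) t) (hF : ∀ t, HasDerivAt F (f t) t)
    (h : ∀ t, T ≤ t → f' t ≤ K * f t) (h0 : ∀ t, T ≤ t → 0 ≤ f t)
    (hM : ∀ t, T ≤ t → F t ≤ M) : Tendsto f atTop (𝓝 0) := by
  -- The previous lemma for `-f`, with `F` as the bounded primitive, gives a limit; a positive limit
  -- of `f` would make `F` unbounded.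
  obtain ⟨l, hl⟩ := exists_tendsto_of_neg_le_hasDerivAt hK (fun t => (hf t).neg) hF
    (fun t ht => neg_le_neg (h t ht)) h0 (B := 0) (fun t ht => by simpa using h0 t ht) hM
  have hl' : Tendsto f atTop (𝓝 (-l)) := by simpa using hl.neg
  have hl0 : 0 ≤ -l := ge_of_tendsto hl' (by
    filter_upwards [eventually_ge_atTop T] with t ht using h0 t ht)
  rcases hl0.eq_or_lt with h1 | h1
  · rwa [h1]
  · exfalso
    obtain ⟨S, hS⟩ := eventually_atTop.1 (hl'.eventually_const_le (half_lt_self h1))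
    have := tendsto_atTop_of_le_hasDerivAt (half_pos h1) hF hS
    obtain ⟨t, ht, ht'⟩ := ((this.eventually_gt_atTop M).and (eventually_ge_atTop T)).exists
    exact absurd (hM t ht') (not_le.2 ht)

/-! ### Autonomous differential equations -/

section Autonomous

variable {E : Type*} [NormedAddCommGroup E] [NormedSpace ℝ E] [FiniteDimensional ℝ E]

/-- `F` is Lipschitz only locally: on a compact subinterval both curves stay in a common closed
ball, which is convex and compact, so `F` is Lipschitz there. -/
theorem eqOn_Ioo_of_contDiff {F : E → E} (hF : ContDiff ℝ 1 F) {T : ℝ} {γ δ : ℝ → E}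
    (hγ : ∀ t ∈ Ioo (-T) T, HasDerivAt γ (F (γ t)) t)
    (hδ : ∀ t ∈ Ioo (-T) T, HasDerivAt δ (F (δ t)) t) (h : γ 0 = δ 0) :
    EqOn γ δ (Ioo (-T) T) := by
  intro t ht
  have hT : |t| < T := abs_lt.2 ht
  obtain ⟨S, htS, hST⟩ := exists_between hT
  have hsub : Icc (-S) S ⊆ Ioo (-T) T := Icc_subset_Ioo (by linarith) hST
  have hb : ∀ α : ℝ → E, (∀ t ∈ Ioo (-T) T, HasDerivAt α (F (α t)) t) →
      ∃ R, ∀ t ∈ Ioo (-S) S, α t ∈ Metric.closedBall (0 : E) R := fun α hα => by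
    obtain ⟨R, hR⟩ := isCompact_Icc.exists_bound_of_continuousOn (s := Icc (-S) S) (f := α)
      (fun t ht => (hα t (hsub ht)).continuousAt.continuousWithinAt)
    exact ⟨R, fun t ht => by simpa using hR t (Ioo_subset_Icc_self ht)⟩
  obtain ⟨R₁, hR₁⟩ := hb γ hγ
  obtain ⟨R₂, hR₂⟩ := hb δ hδ
  obtain ⟨K, hK⟩ := hF.contDiffOn.exists_lipschitzOnWith (s := Metric.closedBall (0 : E) (max R₁ R₂))
    one_ne_zero (convex_closedBall _ _) (isCompact_closedBall _ _)
  have h0 : (0 : ℝ) ∈ Ioo (-S) S := by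
    have := abs_nonneg t
    constructor <;> linarith
  exact ODE_solution_unique_of_mem_Ioo (v := fun _ => F)
    (s := fun _ => Metric.closedBall (0 : E) (max R₁ R₂)) (fun _ _ => hK) h0
    (fun t ht => ⟨hγ t (hsub (Ioo_subset_Icc_self ht)),
      Metric.closedBall_subset_closedBall (le_max_left _ _) (hR₁ t ht)⟩)
    (fun t ht => ⟨hδ t (hsub (Ioo_subset_Icc_self ht)),
      Metric.closedBall_subset_closedBall (le_max_right _ _) (hR₂ t ht)⟩) h (abs_lt.1 htS)

theorem eq_of_contDiff {F : E → E} (hF : ContDiff ℝ 1 F) {γ δ : ℝ → E}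
    (hγ : ∀ t, HasDerivAt γ (F (γ t)) t) (hδ : ∀ t, HasDerivAt δ (F (δ t)) t)
    (h : γ 0 = δ 0) : γ = δ :=
  funext fun t => eqOn_Ioo_of_contDiff hF (T := |t| + 1) (fun t _ => hγ t) (fun t _ => hδ t) h
    (abs_lt.1 (lt_add_one _))

theorem exists_global_of_forall_Ioo {F : E → E} (hF : ContDiff ℝ 1 F) {p : E}
    (h : ∀ T : ℝ, 0 < T → ∃ γ : ℝ → E, γ 0 = p ∧ ∀ t ∈ Ioo (-T) T, HasDerivAt γ (F (γ t)) t) :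
    ∃ γ : ℝ → E, γ 0 = p ∧ ∀ t, HasDerivAt γ (F (γ t)) t := by
  have hpos : ∀ t : ℝ, 0 < |t| + 1 := fun t => by positivity
  choose! α hα0 hα using h
  -- The value at `t` is taken from the solution on an interval around `t`; by uniqueness nearby
  -- times may use that same solution.
  refine ⟨fun t => α (|t| + 1) t, hα0 _ (hpos 0), fun t => ?_⟩
  have hev : (fun t => α (|t| + 1) t) =ᶠ[𝓝 t] α (|t| + 1) := by
    filter_upwards [(isOpen_Ioo (a := -(|t| + 1)) (b := |t| + 1)).mem_nhds
      (abs_lt.1 (lt_add_one |t|))] with u hu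
    have hm : min (|u| + 1) (|t| + 1) ≤ |u| + 1 := min_le_left _ _
    have hm' : min (|u| + 1) (|t| + 1) ≤ |t| + 1 := min_le_right _ _
    refine eqOn_Ioo_of_contDiff hF (T := min (|u| + 1) (|t| + 1))
      (fun r hr => hα _ (hpos u) r ⟨by linarith [hr.1], by linarith [hr.2]⟩)
      (fun r hr => hα _ (hpos t) r ⟨by linarith [hr.1], by linarith [hr.2]⟩) ?_
      (abs_lt.1 (lt_min (lt_add_one _) (abs_lt.2 hu)))
    rw [hα0 _ (hpos u), hα0 _ (hpos t)]
  exact (hα _ (hpos t) t (abs_lt.1 (lt_add_one |t|))).congr_of_eventuallyEq hev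

theorem exists_global_of_hasCompactSupport {F : E → E} (hF : ContDiff ℝ 1 F)
    (hc : HasCompactSupport F) (p : E) :
    ∃ γ : ℝ → E, γ 0 = p ∧ ∀ t, HasDerivAt γ (F (γ t)) t := by
  refine exists_global_of_forall_Ioo hF fun T hT => ?_
  obtain ⟨K, hK⟩ := hF.lipschitzWith_of_hasCompactSupport hc one_ne_zero
  obtain ⟨C, hC⟩ := hc.exists_bound_of_continuous hF.continuous
  have hC0 : 0 ≤ C := (norm_nonneg _).trans (hC 0)
  -- In time `T` a curve of speed at most `C` stays within `C * T` of `p`, so a single application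
  -- covers `[-T, T]`.
  have hPL : IsPicardLindelof (fun _ => F) (tmin := -T) (tmax := T) ⟨0, by simp [hT.le]⟩ p
      (C.toNNReal * T.toNNReal) 0 C.toNNReal K :=
    { lipschitzOnWith := fun _ _ => hK.lipschitzOnWith
      continuousOn := fun _ _ => continuousOn_const
      norm_le := fun _ _ x _ => by simpa [hC0] using hC x
      mul_max_le := by simp [hT.le, hC0] }
  obtain ⟨γ, hγ0, hγ⟩ := hPL.exists_eq_forall_mem_Icc_hasDerivWithinAt₀
  exact ⟨γ, hγ0, fun t ht => (hγ t (Ioo_subset_Icc_self ht)).hasDerivAt (Icc_mem_nhds ht.1 ht.2)⟩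

/-- If all solutions of the equations obtained from `F` by a smooth rescaling of time
are bounded a priori on bounded time intervals, then there is a global solution. -/
theorem exists_global_of_rescaled_bound {F : E → E} (hF : ContDiff ℝ 1 F) {p : E}
    (h : ∀ T : ℝ, 0 < T → ∃ R, 0 < R ∧ ∀ (χ : E → ℝ) (γ : ℝ → E), Continuous χ →
      (∀ q, χ q ∈ Icc (0 : ℝ) 1) → γ 0 = p → (∀ t, HasDerivAt γ (χ (γ t) • F (γ t)) t) →
      ∀ t ∈ Ioo (-T) T, ‖γ t‖ ≤ R) :
    ∃ γ : ℝ → E, γ 0 = p ∧ ∀ t, HasDerivAt γ (F (γ t)) t := by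
  refine exists_global_of_forall_Ioo hF fun T hT => ?_
  obtain ⟨R, hR, hb⟩ := h T hT
  -- The cut-off equals one on the ball of radius `R`, which the a priori bound keeps the solution
  -- from leaving before time `T`.
  let χ : ContDiffBump (0 : E) := ⟨R, R + 1, hR, lt_add_one R⟩
  have hG : ContDiff ℝ 1 fun q => χ q • F q := χ.contDiff.smul hF
  obtain ⟨γ, hγ0, hγ⟩ := exists_global_of_hasCompactSupport hG χ.hasCompactSupport.smul_right p
  refine ⟨γ, hγ0, fun t ht => ?_⟩
  have hle := hb χ γ χ.continuous (fun q => ⟨χ.nonneg, χ.le_one⟩) hγ0 hγ t ht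
  have := hγ t
  rwa [χ.one_of_mem_closedBall (by simpa using hle), one_smul] at this

end Autonomous

/-! ### Uniqueness and global existence on the constraint set -/

theorem contDiff_vectorField (v : ℝ) : ContDiff ℝ 1 (vectorField v) := by
  rw [contDiff_pi]
  intro i
  fin_cases i <;> simp [vectorField, sigSq, sig2, sig3, sigP, sigM, n2, n3] <;> fun_prop

theorem IsSolution.eq {v : ℝ} {γ δ : ℝ → State} (hγ : IsSolution v γ) (hδ : IsSolution v δ)
    (h : γ 0 = δ 0) : γ = δ :=
  eq_of_contDiff (contDiff_vectorField v) hγ hδ h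

theorem hasDerivAt_state_iff {γ : ℝ → State} {w : State} {t : ℝ} :
    HasDerivAt γ w t ↔ HasDerivAt (fun t => γ t 0) (w 0) t ∧ HasDerivAt (fun t => γ t 1) (w 1) t ∧
      HasDerivAt (fun t => γ t 2) (w 2) t ∧ HasDerivAt (fun t => γ t 3) (w 3) t := by
  rw [hasDerivAt_pi, Fin.forall_fin_succ, Fin.forall_fin_succ, Fin.forall_fin_succ,
    Fin.forall_fin_succ]
  simp

/-- Grönwall's inequality, applied to `t ↦ u (-t)` for negative times. -/
theorem le_mul_exp_of_abs_hasDerivAt_le {u u' : ℝ → ℝ} {K : ℝ} (hu : ∀ t, HasDerivAt u (u' t) t)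
    (h : ∀ t, |u' t| ≤ K * u t) (t : ℝ) : u t ≤ u 0 * Real.exp (K * |t|) := by
  have key : ∀ {u u' : ℝ → ℝ}, (∀ t, HasDerivAt u (u' t) t) → (∀ t, u' t ≤ K * u t) →
      ∀ t, 0 ≤ t → u t ≤ u 0 * Real.exp (K * t) := fun {u u'} hu h t ht => by
    have := le_of_hasDerivAt_nonpos (T := 0) (fun t => (hu t).mul
      ((hasDerivAt_id t).const_mul (-K)).exp) (fun t _ => by
        have := mul_nonneg (sub_nonneg.2 (h t)) (Real.exp_pos (-K * t)).le
        simp only [id]; linarith) ht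
    simp only [Pi.mul_apply, id, mul_zero, Real.exp_zero, mul_one] at this
    calc u t = u t * Real.exp (-K * t) * Real.exp (K * t) := by
          rw [mul_assoc, ← Real.exp_add]; simp
      _ ≤ _ := mul_le_mul_of_nonneg_right this (Real.exp_pos _).le
  rcases le_total 0 t with ht | ht
  · rw [abs_of_nonneg ht]
    exact key hu (fun t => (le_abs_self _).trans (h t)) t ht
  · rw [abs_of_nonpos ht]
    have := key (u := fun t => u (-t)) (u' := fun t => -u' (-t))
      (fun t => by simpa using! (hu (-t)).scomp t (hasDerivAt_neg t))
      (fun t => (neg_le_abs _).trans (h (-t))) (-t) (by linarith)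
    simpa using this

theorem sqrt_three_le_two : √3 ≤ 2 := by
  rw [Real.sqrt_le_left (by norm_num)]; norm_num

/-- Solutions of the equations obtained by a rescaling of time preserve the constraint. -/
theorem constraint_eq_zero_of_rescaled {v : ℝ} {k : ℝ → ℝ} {γ : ℝ → State} (hk : Continuous k)
    (hγ : ∀ t, HasDerivAt γ (k t • vectorField v (γ t)) t) (h0 : constraint (γ 0) = 0) (t : ℝ) :
    constraint (γ t) = 0 := by
  have hc : Continuous γ := continuous_iff_continuousAt.2 fun t => (hγ t).continuousAt
  have hcont : Continuous fun t => k t * (-4 * (sigP (γ t) + 2 * v * sigSq (γ t))) := by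
    unfold sigSq sigP sigM; fun_prop
  obtain ⟨F, hF0, hF⟩ := exists_primitive hcont
  have hd : ∀ t, HasDerivAt (fun t => constraint (γ t))
      (k t * (-4 * (sigP (γ t) + 2 * v * sigSq (γ t))) * constraint (γ t)) t := fun t => by
    obtain ⟨h0, h1, h2, h3⟩ := hasDerivAt_state_iff.1 (hγ t)
    refine ((((h0.pow 2).add (h1.pow 2)).const_sub 1).sub ((h2.sub h3).pow 2)).congr_deriv ?_
    simp [vectorField, sigSq, sig2, sig3, sigP, sigM, n2, n3, constraint]
    ring
  rw [eq_mul_exp_of_hasDerivAt hd hF hF0, h0, zero_mul]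

/-- The constraint bounds `Σ₊`, `Σ₋` and `N₂ - N₃`; only `N₂ + N₃` can grow, and at most
exponentially, uniformly in the rescaling of time. -/
theorem exists_solution {v : ℝ} (hv : v ∈ Ioo (0 : ℝ) 1) {p : State} (hp : constraint p = 0) :
    ∃ γ : ℝ → State, IsSolution v γ ∧ γ 0 = p := by
  obtain ⟨hv0, hv1⟩ := hv
  suffices h : ∃ γ : ℝ → State, γ 0 = p ∧ ∀ t, HasDerivAt γ (vectorField v (γ t)) t by
    obtain ⟨γ, h0, h⟩ := h
    exact ⟨γ, h, h0⟩
  refine exists_global_of_rescaled_bound (contDiff_vectorField v) fun T hT => ?_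
  refine ⟨((n2 p + n3 p) ^ 2 + 1) * Real.exp (20 * T) + 1, by positivity, ?_⟩
  intro χ γ hχ hχ1 h0 hγ t ht
  have hc : Continuous γ := continuous_iff_continuousAt.2 fun t => (hγ t).continuousAt
  have hcon := constraint_eq_zero_of_rescaled (hχ.comp hc) hγ (by rw [h0, hp])
  have hd : ∀ t, HasDerivAt (fun t => (γ t 2 + γ t 3) ^ 2 + 1)
      (χ (γ t) * (-4 * (2 * v * (γ t 0 ^ 2 + γ t 1 ^ 2) + γ t 0) * (γ t 2 + γ t 3) ^ 2
        - 4 * √3 * γ t 1 * (γ t 2 - γ t 3) * (γ t 2 + γ t 3))) t := fun t => by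
    obtain ⟨h0, h1, h2, h3⟩ := hasDerivAt_state_iff.1 (hγ t)
    refine (((h2.add h3).pow 2).add_const 1).congr_deriv ?_
    simp [vectorField, sigSq, sig2, sig3, sigP, sigM, n2, n3]
    ring
  -- The two terms are at most `12 s²` and `4 (s² + 1)`; their sum is below `20 (s² + 1)`. Adding
  -- one to `s²` absorbs the term linear in `s`.
  have hbd := le_mul_exp_of_abs_hasDerivAt_le (K := 20) hd fun t => by
    have hC := hcon t
    simp only [constraint, sigSq, sigP, sigM, n2, n3] at hC
    obtain ⟨hk0, hk1⟩ := hχ1 (γ t)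
    generalize χ (γ t) = k at *
    generalize γ t 0 = x at *
    generalize γ t 1 = y at *
    generalize γ t 2 - γ t 3 = c at *
    generalize γ t 2 + γ t 3 = s at *
    rw [abs_mul, abs_of_nonneg hk0]
    refine (mul_le_of_le_one_left (abs_nonneg _) hk1).trans ?_
    have hx : |x| ≤ 1 := by rw [← sq_le_one_iff_abs_le_one]; nlinarith [sq_nonneg y, sq_nonneg c]
    have hyc : |y * c| ≤ 1 := by rw [← sq_le_one_iff_abs_le_one]; nlinarith [sq_nonneg (y^2 - c^2), sq_nonneg x, sq_nonneg (y^2+c^2)]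
    have h1 : |2 * v * (x ^ 2 + y ^ 2) + x| ≤ 3 := by
      have hxx := abs_le.1 hx
      rw [abs_le]
      constructor <;> nlinarith [sq_nonneg x, sq_nonneg y, sq_nonneg c]
    have h2 : |√3 * (y * c)| ≤ 2 := by
      rw [abs_mul, abs_of_nonneg (Real.sqrt_nonneg 3)]
      nlinarith [sqrt_three_le_two, abs_nonneg (y * c), Real.sqrt_nonneg 3]
    have h3 : |s| ≤ (s ^ 2 + 1) / 2 := by
      rw [abs_le]; constructor <;> nlinarith [sq_nonneg (s - 1), sq_nonneg (s + 1)]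
    calc |-4 * (2 * v * (x ^ 2 + y ^ 2) + x) * s ^ 2 - 4 * √3 * y * c * s|
        = |(-4 * s ^ 2) * (2 * v * (x ^ 2 + y ^ 2) + x) - 4 * (√3 * (y * c)) * s| := by ring_nf
      _ ≤ |(-4 * s ^ 2) * (2 * v * (x ^ 2 + y ^ 2) + x)| + |4 * (√3 * (y * c)) * s| := abs_sub _ _
      _ = 4 * s ^ 2 * |2 * v * (x ^ 2 + y ^ 2) + x| + 4 * |√3 * (y * c)| * |s| := by
          simp only [abs_mul, abs_neg, abs_of_nonneg (sq_nonneg s), abs_of_pos (zero_lt_four' ℝ)]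
      _ ≤ 4 * s ^ 2 * 3 + 4 * 2 * ((s ^ 2 + 1) / 2) := by gcongr
      _ ≤ 20 * (s ^ 2 + 1) := by nlinarith [sq_nonneg s]
  have hM : (γ t 2 + γ t 3) ^ 2 + 1 ≤ ((n2 p + n3 p) ^ 2 + 1) * Real.exp (20 * T) := by
    refine (hbd t).trans ?_
    rw [h0]
    have : |t| ≤ T := (abs_lt.2 ht).le
    simp only [n2, n3]
    gcongr
  have hC := hcon t
  simp only [constraint, sigSq, sigP, sigM, n2, n3] at hC
  generalize ((n2 p + n3 p) ^ 2 + 1) * Real.exp (20 * T) = M at *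
  have hM1 : 1 ≤ M := by nlinarith [sq_nonneg (γ t 2 + γ t 3)]
  have hle : ∀ r : ℝ, r ^ 2 ≤ M → |r| ≤ M + 1 := fun r hr => by
    rw [abs_le]; constructor <;> nlinarith
  rw [pi_norm_le_iff_of_nonneg (by linarith)]
  simp only [Fin.forall_fin_succ, Real.norm_eq_abs]
  refine ⟨hle _ ?_, hle _ ?_, hle _ ?_, hle _ ?_, by simp⟩
  all_goals
    try simp only [Fin.succ_zero_eq_one, Fin.succ_one_eq_two, Fin.isValue]
    try change γ t 3 ^ 2 ≤ M
    nlinarith [sq_nonneg (γ t 0), sq_nonneg (γ t 1), sq_nonneg (γ t 2 - γ t 3),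
      sq_nonneg (γ t 2 + γ t 3)]

/-- The evolution equations on the constraint set in terms of the four coordinate functions. -/
structure ConstrainedSolution (v : ℝ) (x y a b : ℝ → ℝ) : Prop where
  hasDerivAt_x : ∀ t, HasDerivAt x (2 * (a t - b t) ^ 2 * (1 + 2 * v * x t)) t
  hasDerivAt_y : ∀ t, HasDerivAt y
    (4 * v * (a t - b t) ^ 2 * y t + 2 * √3 * (a t - b t) * (a t + b t)) t
  hasDerivAt_a : ∀ t, HasDerivAt a
    (-2 * (2 * v * (1 - (a t - b t) ^ 2) + x t + √3 * y t) * a t) t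
  hasDerivAt_b : ∀ t, HasDerivAt b
    (-2 * (2 * v * (1 - (a t - b t) ^ 2) + x t - √3 * y t) * b t) t
  sphere : ∀ t, x t ^ 2 + y t ^ 2 + (a t - b t) ^ 2 = 1

theorem IsSolution.constrainedSolution {v : ℝ} {γ : ℝ → State} (hγ : IsSolution v γ)
    (h0 : constraint (γ 0) = 0) :
    ConstrainedSolution v (fun t => γ t 0) (fun t => γ t 1) (fun t => γ t 2) (fun t => γ t 3) := by
  have hcon := constraint_eq_zero_of_rescaled (k := fun _ => 1) continuous_const
    (by simpa using! hγ) h0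
  simp only [constraint, sigSq, sigP, sigM, n2, n3] at hcon
  have hS : ∀ t, γ t 0 ^ 2 + γ t 1 ^ 2 = 1 - (γ t 2 - γ t 3) ^ 2 := fun t => by linarith [hcon t]
  constructor <;> intro t
  rotate_left 4
  · linarith [hcon t]
  all_goals
    obtain ⟨h0, h1, h2, h3⟩ := hasDerivAt_state_iff.1 (hγ t)
    simp [vectorField, sigSq, sig2, sig3, sigP, sigM, n2, n3, hS] at h0 h1 h2 h3
  · exact h0
  · exact h1.congr_deriv (by ring)
  · exact h2.congr_deriv (by ring)
  · exact h3.congr_deriv (by ring)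

/-! ### Convergence to the Kasner circle off the exceptional sets -/

namespace ConstrainedSolution

variable {v : ℝ} {x y a b : ℝ → ℝ}

theorem continuous_x (h : ConstrainedSolution v x y a b) : Continuous x :=
  continuous_iff_continuousAt.2 fun t => (h.hasDerivAt_x t).continuousAt

theorem continuous_y (h : ConstrainedSolution v x y a b) : Continuous y :=
  continuous_iff_continuousAt.2 fun t => (h.hasDerivAt_y t).continuousAt

theorem continuous_a (h : ConstrainedSolution v x y a b) : Continuous a :=
  continuous_iff_continuousAt.2 fun t => (h.hasDerivAt_a t).continuousAt

theorem continuous_b (h : ConstrainedSolution v x y a b) : Continuous b :=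
  continuous_iff_continuousAt.2 fun t => (h.hasDerivAt_b t).continuousAt

/-- The reflection which exchanges the two curvature variables. -/
theorem reflect (h : ConstrainedSolution v x y a b) :
    ConstrainedSolution v x (fun t => -y t) b a where
  hasDerivAt_x t := (h.hasDerivAt_x t).congr_deriv (by ring)
  hasDerivAt_y t := (h.hasDerivAt_y t).neg.congr_deriv (by ring)
  hasDerivAt_a t := (h.hasDerivAt_b t).congr_deriv (by ring)
  hasDerivAt_b t := (h.hasDerivAt_a t).congr_deriv (by ring)
  sphere t := by linarith [h.sphere t]

theorem a_eq_mul_exp (h : ConstrainedSolution v x y a b) :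
    ∃ K : ℝ → ℝ, ∀ t, a t = a 0 * Real.exp (K t) := by
  have := h.continuous_x; have := h.continuous_y; have := h.continuous_a; have := h.continuous_b
  obtain ⟨F, hF0, hF⟩ := exists_primitive
    (f := fun t => -2 * (2 * v * (1 - (a t - b t) ^ 2) + x t + √3 * y t)) (by fun_prop)
  exact ⟨F, eq_mul_exp_of_hasDerivAt h.hasDerivAt_a hF hF0⟩

theorem a_pos (h : ConstrainedSolution v x y a b) (h0 : 0 < a 0) (t : ℝ) : 0 < a t := by
  obtain ⟨K, hK⟩ := h.a_eq_mul_exp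
  rw [hK]; positivity

theorem b_pos (h : ConstrainedSolution v x y a b) (h0 : 0 < b 0) (t : ℝ) : 0 < b t :=
  h.reflect.a_pos h0 t

theorem b_eq_zero (h : ConstrainedSolution v x y a b) (h0 : b 0 = 0) (t : ℝ) : b t = 0 := by
  obtain ⟨K, hK⟩ := h.reflect.a_eq_mul_exp
  rw [hK, h0, zero_mul]

/-- The key identity: it makes `Σ₊ = -1/(2v)` invariant and turns the bound on `Σ₊` into a bound on
the integral of `(N₂ - N₃)²` elsewhere. -/
theorem one_add_eq_mul_exp (h : ConstrainedSolution v x y a b) {E : ℝ → ℝ} (hE0 : E 0 = 0)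
    (hE : ∀ t, HasDerivAt E ((a t - b t) ^ 2) t) (t : ℝ) :
    1 + 2 * v * x t = (1 + 2 * v * x 0) * Real.exp (4 * v * E t) :=
  eq_mul_exp_of_hasDerivAt (f := fun t => 1 + 2 * v * x t)
    (k := fun t => 4 * v * (a t - b t) ^ 2)
    (fun t => (((h.hasDerivAt_x t).const_mul (2 * v)).const_add 1).congr_deriv (by ring))
    (fun t => (hE t).const_mul _) (by simp [hE0]) t

theorem x_eq_of_eq (h : ConstrainedSolution v x y a b) (hv : 0 < v) (h0 : x 0 = -1 / (2 * v))
    (t : ℝ) : x t = -1 / (2 * v) := by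
  have := h.continuous_a; have := h.continuous_b
  obtain ⟨E, hE0, hE⟩ := exists_primitive (f := fun t => (a t - b t) ^ 2) (by fun_prop)
  have h1 := h.one_add_eq_mul_exp hE0 hE t
  have h2 : 1 + 2 * v * x 0 = 0 := by rw [h0]; field_simp; ring
  rw [h2, zero_mul] at h1
  field_simp; linarith

theorem abs_x_le (h : ConstrainedSolution v x y a b) (t : ℝ) : |x t| ≤ 1 := by
  rw [← sq_le_one_iff_abs_le_one]
  nlinarith [h.sphere t, sq_nonneg (y t), sq_nonneg (a t - b t)]

theorem abs_y_le (h : ConstrainedSolution v x y a b) (t : ℝ) : |y t| ≤ 1 := by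
  rw [← sq_le_one_iff_abs_le_one]
  nlinarith [h.sphere t, sq_nonneg (x t), sq_nonneg (a t - b t)]

theorem sq_sub_le (h : ConstrainedSolution v x y a b) (t : ℝ) : (a t - b t) ^ 2 ≤ 1 := by
  nlinarith [h.sphere t, sq_nonneg (x t), sq_nonneg (y t)]

theorem abs_sqrt_three_mul_le {c s y : ℝ} (hc : |c| ≤ s) (hy : |y| ≤ 1) :
    |√3 * y * c * s| ≤ 2 * s ^ 2 := by
  have hs : 0 ≤ s := (abs_nonneg c).trans hc
  rw [abs_mul, abs_mul, abs_mul, abs_of_nonneg hs, abs_of_nonneg (Real.sqrt_nonneg 3)]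
  calc √3 * |y| * |c| * s ≤ 2 * 1 * s * s := by gcongr; exact sqrt_three_le_two
    _ = _ := by ring

theorem abs_sub_le_add {a b : ℝ} (ha : 0 < a) (hb : 0 < b) : |a - b| ≤ a + b := by
  rw [abs_le]; constructor <;> linarith

theorem hasDerivAt_sum_sq (h : ConstrainedSolution v x y a b) (t : ℝ) :
    HasDerivAt (fun t => (a t + b t) ^ 2)
      (-4 * (2 * v * (1 - (a t - b t) ^ 2) + x t) * (a t + b t) ^ 2
        - 4 * (√3 * y t * (a t - b t) * (a t + b t))) t :=
  (((h.hasDerivAt_a t).add (h.hasDerivAt_b t)).pow 2).congr_deriv (by simp; ring)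

/-- The contributions of `Σ₋` to the growth rates of `N₂` and `N₃` cancel in the product. -/
theorem hasDerivAt_mul (h : ConstrainedSolution v x y a b) (t : ℝ) :
    HasDerivAt (fun t => a t * b t)
      (-4 * (2 * v * (1 - (a t - b t) ^ 2) + x t) * (a t * b t)) t :=
  ((h.hasDerivAt_a t).mul (h.hasDerivAt_b t)).congr_deriv (by ring)

/-- If `(N₂ + N₃)²` is integrable, then the solution converges to the Kasner circle. -/
theorem exists_limit_of_sum_sq_integrable (hv : v ∈ Ioo (0 : ℝ) 1)
    (h : ConstrainedSolution v x y a b) (ha : ∀ t, 0 < a t) (hb : ∀ t, 0 < b t)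
    {F : ℝ → ℝ} {M : ℝ} (hF : ∀ t, HasDerivAt F ((a t + b t) ^ 2) t) (hM : ∀ t, 0 ≤ t → F t ≤ M) :
    ∃ X Y, Tendsto x atTop (𝓝 X) ∧ Tendsto y atTop (𝓝 Y) ∧ Tendsto a atTop (𝓝 0) ∧
      Tendsto b atTop (𝓝 0) ∧ X ^ 2 + Y ^ 2 = 1 := by
  obtain ⟨hv0, hv1⟩ := hv
  have hcs : ∀ t, |a t - b t| ≤ a t + b t := fun t => abs_sub_le_add (ha t) (hb t)
  have hcs2 : ∀ t, (a t - b t) ^ 2 ≤ (a t + b t) ^ 2 := fun t => by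
    nlinarith [mul_pos (ha t) (hb t)]
  have hycs : ∀ t, |√3 * y t * (a t - b t) * (a t + b t)| ≤ 2 * (a t + b t) ^ 2 := fun t =>
    abs_sqrt_three_mul_le (hcs t) (h.abs_y_le t)
  have hs0 : Tendsto (fun t => (a t + b t) ^ 2) atTop (𝓝 0) := by
    -- `12 = 4 + 8`: the term `-4 x s²` is at most `4 s²`, the mixed term at most `8 s²`, and the
    -- term with `2v(1 - c²)` has a favourable sign.
    refine tendsto_zero_of_hasDerivAt_le (K := 12) (by norm_num) h.hasDerivAt_sum_sq hF
      (fun t _ => ?_) (fun t _ => sq_nonneg _) hM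
    have h1 := (abs_le.1 (hycs t)).1
    have h2 := (abs_le.1 (h.abs_x_le t)).1
    have h3 := mul_nonneg hv0.le (sub_nonneg.2 (h.sq_sub_le t))
    nlinarith [mul_nonneg (sub_nonneg.2 h2) (sq_nonneg (a t + b t)),
      mul_nonneg h3 (sq_nonneg (a t + b t))]
  obtain ⟨X, hX⟩ := exists_tendsto_of_neg_le_hasDerivAt (K := 2) (T := 0) (by norm_num)
    h.hasDerivAt_x hF (fun t _ => by
      have h2 := abs_le.1 (h.abs_x_le t)
      have : -1 ≤ 1 + 2 * v * x t := by nlinarith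
      nlinarith [hcs2 t, sq_nonneg (a t - b t)]) (fun t _ => sq_nonneg _)
    (fun t _ => (abs_le.1 (h.abs_x_le t)).2) hM
  obtain ⟨Y, hY⟩ := exists_tendsto_of_neg_le_hasDerivAt (K := 8) (T := 0) (by norm_num)
    h.hasDerivAt_y hF (fun t _ => by
      have h2 := abs_le.1 (h.abs_y_le t)
      have h1 := (abs_le.1 (abs_sqrt_three_mul_le (y := 1) (hcs t) (by simp))).1
      have : -1 ≤ v * y t := by nlinarith
      nlinarith [hcs2 t, sq_nonneg (a t - b t)]) (fun t _ => sq_nonneg _)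
    (fun t _ => (abs_le.1 (h.abs_y_le t)).2) hM
  have hs : Tendsto (fun t => a t + b t) atTop (𝓝 0) := by
    have := hs0.sqrt
    simp only [Real.sqrt_zero] at this
    exact this.congr fun t => Real.sqrt_sq (add_pos (ha t) (hb t)).le
  have ha0 : Tendsto a atTop (𝓝 0) := squeeze_zero (fun t => (ha t).le)
    (fun t => by linarith [hb t]) hs
  have hb0 : Tendsto b atTop (𝓝 0) := squeeze_zero (fun t => (hb t).le)
    (fun t => by linarith [ha t]) hs
  refine ⟨X, Y, hX, hY, ha0, hb0, ?_⟩
  have := ((hX.pow 2).add (hY.pow 2)).add ((ha0.sub hb0).pow 2)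
  simp only [h.sphere] at this
  have := tendsto_nhds_unique this tendsto_const_nhds
  linarith

/-- A positive `N₂` can only tend to zero where the Kasner circle is not unstable. -/
theorem neg_two_mul_le_of_tendsto (h : ConstrainedSolution v x y a b) (ha : ∀ t, 0 < a t)
    {X Y : ℝ} (hx : Tendsto x atTop (𝓝 X)) (hy : Tendsto y atTop (𝓝 Y))
    (ha0 : Tendsto a atTop (𝓝 0)) (hb0 : Tendsto b atTop (𝓝 0)) : -2 * v ≤ X + √3 * Y := by
  by_contra! hlt
  have hlim : Tendsto (fun t => 2 * v * (1 - (a t - b t) ^ 2) + x t + √3 * y t) atTop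
      (𝓝 (2 * v * (1 - (0 - 0) ^ 2) + X + √3 * Y)) :=
    (((((ha0.sub hb0).pow 2).const_sub 1).const_mul (2 * v)).add hx).add (hy.const_mul _)
  -- With a negative limiting rate, `a` is eventually nondecreasing; being positive it cannot tend
  -- to zero.
  obtain ⟨T, hT⟩ := eventually_atTop.1
    (hlim.eventually_lt_const (u := 0) (by linarith))
  have hm := monotoneOn_Ici_of_hasDerivAt (T := T) h.hasDerivAt_a fun t ht => by
    nlinarith [hT t ht, ha t]
  have : a T ≤ 0 := ge_of_tendsto ha0 (by
    filter_upwards [eventually_ge_atTop T] with t ht using hm self_mem_Ici ht ht)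
  exact absurd (ha T) (not_lt.2 this)

/-- The shear `Σ₊` stays away from `-1/(2v)`, so that `Ω_k` is integrable. -/
theorem exists_primitive_sub_sq_le (hv : v ∈ Ioo (0 : ℝ) 1) (h : ConstrainedSolution v x y a b)
    (h0 : 1 + 2 * v * x 0 ≠ 0) {E : ℝ → ℝ} (hE0 : E 0 = 0)
    (hE : ∀ t, HasDerivAt E ((a t - b t) ^ 2) t) : ∃ M, ∀ t, E t ≤ M := by
  obtain ⟨hv0, hv1⟩ := hv
  have hpos : 0 < |1 + 2 * v * x 0| := abs_pos.2 h0
  refine ⟨Real.log (3 / |1 + 2 * v * x 0|) / (4 * v), fun t => ?_⟩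
  have h1 := congrArg abs (h.one_add_eq_mul_exp hE0 hE t)
  rw [abs_mul, abs_of_pos (Real.exp_pos _)] at h1
  have h2 : |1 + 2 * v * x t| ≤ 3 := by
    have := abs_le.1 (h.abs_x_le t)
    rw [abs_le]; constructor <;> nlinarith
  rw [le_div_iff₀ (by linarith), Real.le_log_iff_exp_le (by positivity), le_div_iff₀ hpos]
  calc _ = |1 + 2 * v * x 0| * Real.exp (4 * v * E t) := by ring_nf
    _ ≤ 3 := h1 ▸ h2

/-- If `Σ₊` has a limit above `-2v`, then `N₂ N₃` is integrable. -/
theorem exists_sum_sq_primitive_le_of_lt (hv : v ∈ Ioo (0 : ℝ) 1)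
    (h : ConstrainedSolution v x y a b) (ha : ∀ t, 0 < a t) (hb : ∀ t, 0 < b t) {E F : ℝ → ℝ}
    {M X : ℝ} (hE : ∀ t, HasDerivAt E ((a t - b t) ^ 2) t) (hM : ∀ t, E t ≤ M)
    (hF : ∀ t, HasDerivAt F ((a t + b t) ^ 2) t)
    (hX : Tendsto x atTop (𝓝 X)) (hlt : -2 * v < X) : ∃ B T, ∀ t, T ≤ t → F t ≤ B := by
  have hca := h.continuous_a
  have hcb := h.continuous_b
  have hcE : Continuous E := continuous_iff_continuousAt.2 fun t => (hE t).continuousAt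
  obtain ⟨G, -, hG⟩ := exists_primitive
    (f := fun t => a t * b t * Real.exp (-(8 * v * E t))) (by fun_prop)
  obtain ⟨δ, hδ, hδX⟩ : ∃ δ, 0 < δ ∧ -2 * v + δ < X := ⟨(X + 2 * v) / 2, by linarith, by linarith⟩
  obtain ⟨T, hT⟩ := eventually_atTop.1 (hX.eventually_const_lt hδX)
  -- The weight `exp(-8vE)`, bounded below because `E ≤ M`, removes the `c²` term from the growth
  -- rate of `ab`. The remaining rate `-4(2v + x)` is eventually below `-4δ`.
  have hQ : ∀ t, HasDerivAt (fun t => a t * b t * Real.exp (-(8 * v * E t)))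
      (-4 * (2 * v + x t) * (a t * b t * Real.exp (-(8 * v * E t)))) t := fun t =>
    ((h.hasDerivAt_mul t).mul ((hE t).const_mul (8 * v)).neg.exp).congr_deriv
      (by simp only [Pi.neg_apply]; ring)
  have hQ0 : ∀ t, 0 < a t * b t * Real.exp (-(8 * v * E t)) := fun t =>
    mul_pos (mul_pos (ha t) (hb t)) (Real.exp_pos _)
  obtain ⟨B, hB⟩ : ∃ B, ∀ t, T ≤ t → G t ≤ B := by
    have := fun t => le_of_hasDerivAt_nonpos (T := T)
      (fun t => (hQ t).add ((hG t).const_mul (4 * δ))) (fun t ht => by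
        nlinarith [hT t ht, hQ0 t]) (t := t)
    simp only [Pi.add_apply] at this
    refine ⟨_, fun t ht => (le_div_iff₀' (by positivity : 0 < 4 * δ)).2
      (le_trans ?_ (this t ht))⟩
    linarith [hQ0 t]
  -- This is `s² = c² + 4ab` with `ab` bounded by `exp(8vM)` times the weighted product.
  have hle := fun t => le_of_hasDerivAt_nonpos (T := T)
    (fun t => ((hF t).sub (hE t)).sub ((hG t).const_mul (4 * Real.exp (8 * v * M)))) (fun t _ => by
      have : a t * b t ≤ Real.exp (8 * v * M) * (a t * b t * Real.exp (-(8 * v * E t))) := by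
        have h1 : 1 ≤ Real.exp (8 * v * M) * Real.exp (-(8 * v * E t)) := by
          rw [← Real.exp_add, Real.one_le_exp_iff]
          nlinarith [hv.1, hM t]
        nlinarith [mul_pos (ha t) (hb t)]
      nlinarith) (t := t)
  simp only [Pi.sub_apply] at hle
  refine ⟨M + 4 * Real.exp (8 * v * M) * B +
    (F T - E T - 4 * Real.exp (8 * v * M) * G T), T, fun t ht => ?_⟩
  have := mul_le_mul_of_nonneg_left (hB t ht) (by positivity : 0 ≤ 4 * Real.exp (8 * v * M))
  linarith [hle t ht, hM t]

theorem abs_mul_div_le (ha : ∀ t, 0 < a t) (hb : ∀ t, 0 < b t) (t : ℝ) :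
    |y t * (a t - b t) / (a t + b t)| ≤ |y t| := by
  have hs := add_pos (ha t) (hb t)
  rw [abs_div, abs_mul, abs_of_pos hs, div_le_iff₀ hs]
  exact mul_le_mul_of_nonneg_left (abs_sub_le_add (ha t) (hb t)) (abs_nonneg _)

/-- Since `4ab/s² = 1 - c²/s²`, the derivative is `2√3 (c² - y²)` up to terms controlled by `c²` and
`c²/s²`. As `w = yc/s` is bounded, this compares the integrals of `c²` and `y²` when `s` is large.
-/
theorem hasDerivAt_mul_div (h : ConstrainedSolution v x y a b) (ha : ∀ t, 0 < a t)
    (hb : ∀ t, 0 < b t) (t : ℝ) :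
    HasDerivAt (fun t => y t * (a t - b t) / (a t + b t))
      (2 * √3 * (a t - b t) ^ 2 + 4 * v * (a t - b t) ^ 2 * (y t * (a t - b t) / (a t + b t))
        - 8 * √3 * y t ^ 2 * (a t * b t / (a t + b t) ^ 2)) t := by
  have hs := (add_pos (ha t) (hb t)).ne'
  refine (((h.hasDerivAt_y t).mul ((h.hasDerivAt_a t).sub (h.hasDerivAt_b t))).div
    ((h.hasDerivAt_a t).add (h.hasDerivAt_b t)) hs).congr_deriv ?_
  simp only [Pi.mul_apply, Pi.sub_apply, Pi.add_apply]
  field_simp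
  ring

theorem hasDerivAt_mul_div_sq (h : ConstrainedSolution v x y a b) (ha : ∀ t, 0 < a t)
    (hb : ∀ t, 0 < b t) (t : ℝ) :
    HasDerivAt (fun t => a t * b t / (a t + b t) ^ 2)
      (4 * √3 * (y t * (a t - b t) / (a t + b t)) * (a t * b t / (a t + b t) ^ 2)) t := by
  have hs := (add_pos (ha t) (hb t)).ne'
  refine ((h.hasDerivAt_mul t).div (h.hasDerivAt_sum_sq t) (pow_ne_zero 2 hs)).congr_deriv ?_
  field_simp
  ring

theorem mul_div_sq_le (ha : ∀ t, 0 < a t) (hb : ∀ t, 0 < b t) (t : ℝ) :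
    a t * b t / (a t + b t) ^ 2 ≤ 1 / 4 := by
  have hs := add_pos (ha t) (hb t)
  rw [div_le_div_iff₀ (by positivity) (by norm_num)]
  nlinarith [sq_nonneg (a t - b t)]

/-- If the limit of `Σ₊` is not extremal, the rapid oscillation of `(Σ₋, N₂ - N₃)` for large
`N₂ + N₃` is incompatible with the integrability of `(N₂ - N₃)²`. -/
theorem exists_sum_sq_primitive_le_of_sq_lt_one (hv : v ∈ Ioo (0 : ℝ) 1)
    (h : ConstrainedSolution v x y a b) (ha : ∀ t, 0 < a t) (hb : ∀ t, 0 < b t) {E F : ℝ → ℝ}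
    {M X : ℝ} (hE : ∀ t, HasDerivAt E ((a t - b t) ^ 2) t) (hM : ∀ t, E t ≤ M)
    (hF : ∀ t, HasDerivAt F ((a t + b t) ^ 2) t)
    (hX : Tendsto x atTop (𝓝 X)) (hlt : X ^ 2 < 1) : ∃ B T, ∀ t, T ≤ t → F t ≤ B := by
  obtain ⟨hv0, hv1⟩ := hv
  have hca := h.continuous_a
  have hcb := h.continuous_b
  have h3 := sqrt_three_le_two
  have h3' : (0 : ℝ) < √3 := by positivity
  have hg0 : ∀ t, 0 < a t * b t / (a t + b t) ^ 2 := fun t =>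
    div_pos (mul_pos (ha t) (hb t)) (pow_pos (add_pos (ha t) (hb t)) 2)
  have hw1 : ∀ t, |y t * (a t - b t) / (a t + b t)| ≤ 1 := fun t =>
    (abs_mul_div_le ha hb t).trans (h.abs_y_le t)
  obtain ⟨G, -, hG⟩ := exists_primitive (f := fun t => a t * b t / (a t + b t) ^ 2)
    (continuous_iff_continuousAt.2 fun t => (h.hasDerivAt_mul_div_sq ha hb t).continuousAt)
  obtain ⟨δ, hδ, hδX⟩ : ∃ δ, 0 < δ ∧ X ^ 2 < 1 - δ :=
    ⟨(1 - X ^ 2) / 2, by linarith, by linarith⟩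
  obtain ⟨T, hT⟩ := eventually_atTop.1 ((hX.pow 2).eventually_lt_const hδX)
  obtain ⟨B, hB⟩ : ∃ B, ∀ t, T ≤ t → G t ≤ B := by
    -- With `g = ab/s²`, `w - 12 E + 8√3 δ G` is nonincreasing: `y² ≥ δ - c²` and `g ≤ 1/4` leave
    -- the coefficient `2√3 + 4 + 2√3 - 12 ≤ 0` of `c²`. Hence `g` is integrable.
    have := fun t => le_of_hasDerivAt_nonpos (T := T)
      (fun t => ((h.hasDerivAt_mul_div ha hb t).sub ((hE t).const_mul 12)).add
        ((hG t).const_mul (8 * √3 * δ))) (fun t ht => by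
        have hw := (abs_le.1 (hw1 t)).2
        have hg := mul_div_sq_le ha hb t
        have hgp := hg0 t
        have hsph := h.sphere t
        have hTt := hT t ht
        generalize y t * (a t - b t) / (a t + b t) = w at *
        generalize a t * b t / (a t + b t) ^ 2 = g at *
        have h1 : δ * g - (a t - b t) ^ 2 * (1 / 4) ≤ y t ^ 2 * g := by
          nlinarith [mul_nonneg (sq_nonneg (a t - b t)) (sub_nonneg.2 hg)]
        have h2 : v * ((a t - b t) ^ 2 * w) ≤ (a t - b t) ^ 2 := by
          have : (a t - b t) ^ 2 * w ≤ (a t - b t) ^ 2 := by nlinarith [sq_nonneg (a t - b t)]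
          nlinarith [sq_nonneg (a t - b t)]
        nlinarith [sq_nonneg (a t - b t), mul_le_mul_of_nonneg_left h1 h3'.le,
          mul_nonneg (sq_nonneg (a t - b t)) (sub_nonneg.2 h3)]) (t := t)
    simp only [Pi.add_apply, Pi.sub_apply] at this
    refine ⟨_, fun t ht => (le_div_iff₀' (by positivity : 0 < 8 * √3 * δ)).2
      (le_trans (b := _ + 1 + 12 * M) ?_ (add_le_add_left (add_le_add_left (this t ht) 1) _))⟩
    linarith [(abs_le.1 (hw1 t)).1, hM t]
  have hg : Tendsto (fun t => a t * b t / (a t + b t) ^ 2) atTop (𝓝 0) :=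
    tendsto_zero_of_hasDerivAt_le (K := 8) (by norm_num) (h.hasDerivAt_mul_div_sq ha hb) hG
      (fun t _ => by
        have : √3 * (y t * (a t - b t) / (a t + b t)) ≤ 2 := by
          nlinarith [(abs_le.1 (hw1 t)).2]
        nlinarith [hg0 t]) (fun t _ => (hg0 t).le) hB
  -- `ab/s² < 1/8` means `s² < 2c²`, because `s² = c² + 4ab`.
  obtain ⟨S, hS⟩ := eventually_atTop.1 (hg.eventually_lt_const (u := 1 / 8) (by norm_num))
  have hle := fun t => le_of_hasDerivAt_nonpos (T := S)
    (fun t => (hF t).sub ((hE t).const_mul 2)) (fun t ht => by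
      have := hS t ht
      rw [div_lt_iff₀ (pow_pos (add_pos (ha t) (hb t)) 2)] at this
      nlinarith) (t := t)
  simp only [Pi.sub_apply] at hle
  exact ⟨2 * M + (F S - 2 * E S), S, fun t ht => by linarith [hle t ht, hM t]⟩

/-- Every solution outside of the exceptional sets converges to a point of the Kasner circle. -/
theorem exists_limit (hv : v ∈ Ioo (0 : ℝ) 1) (h : ConstrainedSolution v x y a b)
    (ha : ∀ t, 0 < a t) (hb : ∀ t, 0 < b t) (h0 : 1 + 2 * v * x 0 ≠ 0)
    (h1 : v ≤ 1 / 2 → x 0 ≠ -1) :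
    ∃ X Y, Tendsto x atTop (𝓝 X) ∧ Tendsto y atTop (𝓝 Y) ∧ Tendsto a atTop (𝓝 0) ∧
      Tendsto b atTop (𝓝 0) ∧ X ^ 2 + Y ^ 2 = 1 ∧ (v ≤ 1 / 2 → X ≠ -1) := by
  have hca := h.continuous_a
  have hcb := h.continuous_b
  obtain ⟨E, hE0, hE⟩ := exists_primitive (f := fun t => (a t - b t) ^ 2) (by fun_prop)
  obtain ⟨F, -, hF⟩ := exists_primitive (f := fun t => (a t + b t) ^ 2) (by fun_prop)
  obtain ⟨M, hM⟩ := h.exists_primitive_sub_sq_le hv h0 hE0 hE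
  obtain ⟨X, hX⟩ := exists_tendsto_of_neg_le_hasDerivAt (K := 2) (T := 0) (by norm_num)
    h.hasDerivAt_x hE (fun t _ => by
      have h2 := abs_le.1 (h.abs_x_le t)
      have : -1 ≤ 1 + 2 * v * x t := by nlinarith [hv.1, hv.2]
      nlinarith [sq_nonneg (a t - b t)]) (fun t _ => sq_nonneg _)
    (fun t _ => (abs_le.1 (h.abs_x_le t)).2) (fun t _ => hM t)
  have hX1 : |X| ≤ 1 := le_of_tendsto hX.abs (Eventually.of_forall h.abs_x_le)
  -- Here `1 + 2vx ≥ 0`, so `x` is nondecreasing and can tend to `-1` only if it starts there.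
  have hXne : v ≤ 1 / 2 → X ≠ -1 := fun hv2 hX' => by
    have hm := monotoneOn_Ici_of_hasDerivAt (T := 0) h.hasDerivAt_x fun t _ => by
      have h2 := abs_le.1 (h.abs_x_le t)
      have : 0 ≤ 1 + 2 * v * x t := by nlinarith [hv.1]
      positivity
    have : x 0 ≤ X := ge_of_tendsto hX (by
      filter_upwards [eventually_ge_atTop 0] with t ht using hm self_mem_Ici ht ht)
    exact h1 hv2 (le_antisymm (this.trans hX'.le) (abs_le.1 (h.abs_x_le 0)).1)
  obtain ⟨B, T, hB⟩ : ∃ B T, ∀ t, T ≤ t → F t ≤ B := by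
    by_cases hlt : -2 * v < X
    · exact h.exists_sum_sq_primitive_le_of_lt hv ha hb hE hM hF hX hlt
    -- `X ≤ -2v` and `|X| ≤ 1` force `v ≤ 1/2`, where `X = -1` has been excluded.
    · refine h.exists_sum_sq_primitive_le_of_sq_lt_one hv ha hb hE hM hF hX ?_
      have hX2 := abs_le.1 hX1
      rw [sq_lt_one_iff_abs_lt_one, abs_lt]
      refine ⟨lt_of_le_of_ne hX2.1 fun hc => ?_, by linarith [hv.1]⟩
      rcases le_or_gt v (1 / 2) with h2 | h2
      · exact hXne h2 hc.symm
      · linarith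
  have hFm : MonotoneOn F (Ici 0) := monotoneOn_Ici_of_hasDerivAt hF fun t _ => sq_nonneg _
  obtain ⟨X', Y, hX', hY, ha0, hb0, hXY⟩ := h.exists_limit_of_sum_sq_integrable hv ha hb hF
    (M := B) fun t ht => (hFm ht (ht.trans (le_max_left _ T)) (le_max_left _ _)).trans
      (hB _ (le_max_right _ _))
  obtain rfl := tendsto_nhds_unique hX hX'
  exact ⟨X, Y, hX, hY, ha0, hb0, hXY, hXne⟩

end ConstrainedSolution

/-! ### The stable set and the generic limit sets -/

/-- Rotation of the Kasner circle. -/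
def rotate (p : State) (θ : ℝ) : State :=
  ![p 0 * Real.cos θ - p 1 * Real.sin θ, p 0 * Real.sin θ + p 1 * Real.cos θ, 0, 0]

theorem continuous_rotate (p : State) : Continuous (rotate p) := by
  refine continuous_pi fun i => ?_
  fin_cases i <;> simp [rotate] <;> fun_prop

theorem rotate_mem {p : State} (hp : p ∈ kasnerCircle) (θ : ℝ) : rotate p θ ∈ kasnerCircle := by
  have h := hp.1
  simp only [sigSq, sigP, sigM] at h
  refine ⟨?_, rfl, rfl⟩
  simp only [sigSq, sigP, sigM, rotate, Matrix.cons_val_zero, Matrix.cons_val_one]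
  linear_combination (Real.sin θ ^ 2 + Real.cos θ ^ 2) * h + Real.sin_sq_add_cos_sq θ

theorem rotate_zero {p : State} (hp : p ∈ kasnerCircle) : rotate p 0 = p := by
  ext i
  fin_cases i
  · simp [rotate]
  · simp [rotate]
  · exact hp.2.1.symm
  · exact hp.2.2.symm

/-- If one of the linear functions defining the arcs has the critical value `-2v` at a point of the
Kasner circle and the other one is larger, then there are points outside of the arcs nearby. -/
theorem not_mem_nhdsWithin_of_eq {v r : ℝ} (hv : v ∈ Ioo (0 : ℝ) 1) {p : State} {U : Set State}
    (hr : r ^ 2 = 3) (hp : p ∈ kasnerCircle) (h : p 0 + r * p 1 = -2 * v)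
    (h' : -2 * v < p 0 - r * p 1)
    (hU : ∀ q ∈ U, q 0 + r * q 1 ≤ -2 * v ∨ q 0 - r * q 1 ≤ -2 * v) : U ∉ 𝓝[kasnerCircle] p := by
  intro hUp
  have hsq : p 0 ^ 2 + p 1 ^ 2 = 1 := hp.1
  -- `k` is the derivative of `p 0 + r * p 1` under rotation; it is nonzero since `v < 1`. Rotating
  -- by `k * ε` therefore increases this function for small `ε > 0`.
  set k := r * p 0 - p 1 with hk
  have hk2 : k ^ 2 = 4 - 4 * v ^ 2 := by
    have : k ^ 2 + (p 0 + r * p 1) ^ 2 = 4 := by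
      rw [hk]; linear_combination (1 + r ^ 2) * hsq + hr
    rw [h] at this; linarith
  have hk0 : k ≠ 0 := fun h0 => by
    rw [h0] at hk2; nlinarith [hv.1, hv.2]
  have hlim : Tendsto (fun ε : ℝ => rotate p (k * ε)) (𝓝[>] 0) (𝓝[kasnerCircle] p) := by
    refine tendsto_nhdsWithin_iff.2 ⟨?_, Eventually.of_forall fun _ => rotate_mem hp _⟩
    have hc : Continuous fun ε : ℝ => rotate p (k * ε) := (continuous_rotate p).comp (by fun_prop)
    have := hc.tendsto 0
    simp only [mul_zero, rotate_zero hp] at this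
    exact this.mono_left nhdsWithin_le_nhds
  have hfar : ∀ᶠ ε : ℝ in 𝓝[>] 0,
      -2 * v < rotate p (k * ε) 0 - r * rotate p (k * ε) 1 := by
    refine Tendsto.eventually_const_lt h' ?_
    have hc : Continuous fun q : State => q 0 - r * q 1 := by fun_prop
    exact (hc.tendsto p).comp (tendsto_nhds_of_tendsto_nhdsWithin hlim)
  have hsin : ∀ᶠ ε : ℝ in 𝓝[>] 0, 0 < k * Real.sin (k * ε) := by
    have hkp : 0 < |k| := abs_pos.2 hk0
    have hlt : ∀ᶠ ε : ℝ in 𝓝[>] 0, ε < Real.pi / |k| :=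
      nhdsWithin_le_nhds (gt_mem_nhds (div_pos Real.pi_pos hkp))
    filter_upwards [hlt, self_mem_nhdsWithin] with ε hε hε0
    have hs := Real.sin_pos_of_pos_of_lt_pi (mul_pos hkp hε0) ((lt_div_iff₀' hkp).1 hε)
    rcases abs_cases k with ⟨hc, -⟩ | ⟨hc, -⟩
    · rw [hc] at hs hkp; exact mul_pos hkp hs
    · rw [hc, neg_mul, Real.sin_neg] at hs; rw [hc] at hkp
      nlinarith
  obtain ⟨ε, hε1, hε2, hε3⟩ := (hfar.and (hsin.and (hlim.eventually hUp))).exists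
  rcases hU _ hε3 with h1 | h1
  · have : rotate p (k * ε) 0 + r * rotate p (k * ε) 1 =
        (p 0 + r * p 1) * Real.cos (k * ε) + k * Real.sin (k * ε) := by
      simp [rotate, hk]; ring
    rw [this, h] at h1
    nlinarith [Real.cos_le_one (k * ε), hv.1]
  · exact absurd h1 (not_le.2 hε1)

/-- If both inequalities are strict, `p` lies in neither arc; if one is an equality, `p` is an
endpoint that a small rotation moves out of both arcs. Two equalities give `Σ₋ = 0` and `Σ₊ = -2v`,
hence `v = 1/2` and `Σ₊ = -1`, which is excluded. -/
theorem mem_stableSet {v : ℝ} (hv : v ∈ Ioo (0 : ℝ) 1) {p : State} (hp : p ∈ kasnerCircle)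
    (h2 : -2 * v ≤ p 0 + √3 * p 1) (h3 : -2 * v ≤ p 0 - √3 * p 1)
    (hne : v ≤ 1 / 2 → p 0 ≠ -1) : p ∈ stableSet v := by
  refine ⟨hp, fun hn => ?_⟩
  have hr : (√3 : ℝ) ^ 2 = 3 := Real.sq_sqrt (by norm_num)
  have hr' : (-√3 : ℝ) ^ 2 = 3 := by rw [neg_sq, hr]
  have hU : ∀ q ∈ arc2 v ∪ arc3 v, q 0 + √3 * q 1 ≤ -2 * v ∨ q 0 - √3 * q 1 ≤ -2 * v := by
    rintro q (hq | hq)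
    exacts [Or.inl hq.2, Or.inr hq.2]
  rcases h2.eq_or_lt with h2 | h2 <;> rcases h3.eq_or_lt with h3 | h3
  · have hsq : p 0 ^ 2 + p 1 ^ 2 = 1 := hp.1
    have h1 : p 1 = 0 := by
      have : √3 * p 1 = 0 := by linarith
      simpa using this
    have h0 : p 0 = -2 * v := by rw [h2, h1]; ring
    have hv2 : (2 * v - 1) * (2 * v + 1) = 0 := by
      rw [h0, h1] at hsq; linarith
    have : v = 1 / 2 := by
      rcases mul_eq_zero.1 hv2 with h | h <;> linarith [hv.1]
    exact hne this.le (by rw [h0, this]; norm_num)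
  · exact not_mem_nhdsWithin_of_eq hv hr hp h2.symm h3 hU hn
  · exact not_mem_nhdsWithin_of_eq hv hr' hp (by linarith) (by linarith) (fun q hq => by
      rcases hU q hq with h | h
      · right; linarith
      · left; linarith) hn
  · rcases hU p (mem_of_mem_nhdsWithin hp hn) with h | h <;> linarith

theorem _root_.MapClusterPt.eq_of_tendsto {α X : Type*} [TopologicalSpace X] [T2Space X]
    {u : α → X} {l : Filter α} {p q : X} (h : MapClusterPt p l u) (hu : Tendsto u l (𝓝 q)) :
    p = q :=
  eq_of_nhds_neBot (h.clusterPt.mono (Filter.map_le_iff_le_comap.2 hu.le_comap))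

/-- Orbits outside of the exceptional sets converge to the stable set. -/
theorem omegaLimitSet_nonempty_and_subset {v : ℝ} (hv : v ∈ Ioo (0 : ℝ) 1) {γ : ℝ → State}
    (hγ : IsSolution v γ) (h0 : γ 0 ∈ typeVII0) (hl : v ≤ 1 / 2 → γ 0 ∉ lrsMinus)
    (hs : 1 / 2 < v → γ 0 ∉ separatrix v) :
    (omegaLimitSet γ).Nonempty ∧ omegaLimitSet γ ⊆ stableSet v := by
  have h := hγ.constrainedSolution h0.1
  have ha := h.a_pos h0.2.1
  have hb := h.b_pos h0.2.2
  have hx1 : v ≤ 1 / 2 → γ 0 0 ≠ -1 := fun hv2 hx => by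
    have hsph := h.sphere 0
    simp only [hx] at hsph
    have h1 : γ 0 1 = 0 := by nlinarith [sq_nonneg (γ 0 1), sq_nonneg (γ 0 2 - γ 0 3)]
    have h2 : γ 0 2 - γ 0 3 = 0 := by nlinarith [sq_nonneg (γ 0 1), sq_nonneg (γ 0 2 - γ 0 3)]
    exact hl hv2 ⟨hx, h1, sub_eq_zero.1 h2, h0.2.1⟩
  have hne : 1 + 2 * v * γ 0 0 ≠ 0 := fun hc => by
    rcases le_or_gt v (1 / 2) with hv2 | hv2
    · have hx := (abs_le.1 (h.abs_x_le 0)).1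
      refine hx1 hv2 (le_antisymm ?_ hx)
      by_contra! hlt
      nlinarith [hv.1]
    · refine hs hv2 ⟨h0, ?_⟩
      have := hv.1
      simp only [sigP]
      field_simp
      linarith
  obtain ⟨X, Y, hX, hY, ha0, hb0, hXY, hXne⟩ := h.exists_limit hv ha hb hne hx1
  have hlim : Tendsto γ atTop (𝓝 ![X, Y, 0, 0]) := by
    rw [tendsto_pi_nhds]
    intro i
    fin_cases i
    exacts [hX, hY, ha0, hb0]
  have hmem : (![X, Y, 0, 0] : State) ∈ stableSet v :=
    mem_stableSet hv ⟨hXY, rfl, rfl⟩ (h.neg_two_mul_le_of_tendsto ha hX hY ha0 hb0)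
      (by simpa [sub_eq_add_neg] using
        h.reflect.neg_two_mul_le_of_tendsto hb hX hY.neg hb0 ha0) hXne
  refine ⟨⟨_, (mem_omegaLimitSet_iff _ _).2 hlim.mapClusterPt⟩, fun q hq => ?_⟩
  have := (mem_omegaLimitSet_iff _ _).1 hq
  rwa [← this.eq_of_tendsto hlim] at hmem

/-! ### The line `Σ₊ = -1/(2v)` -/

/-- The radius of the circle in which the plane `Σ₊ = -1/(2v)` meets the unit sphere. -/
def sepRadius (v : ℝ) : ℝ := √(1 - (-1 / (2 * v)) ^ 2)

theorem sepRadius_sq {v : ℝ} (hv : 1 / 2 < v) : sepRadius v ^ 2 = 1 - (-1 / (2 * v)) ^ 2 := by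
  refine Real.sq_sqrt (sub_nonneg.2 ?_)
  rw [sq_le_one_iff_abs_le_one, abs_div, abs_neg, abs_one, abs_of_pos (by linarith),
    div_le_one (by linarith)]
  linarith

theorem sepRadius_pos {v : ℝ} (hv : 1 / 2 < v) : 0 < sepRadius v := by
  refine Real.sqrt_pos.2 (sub_pos.2 ?_)
  rw [sq_lt_one_iff_abs_lt_one, abs_div, abs_neg, abs_one, abs_of_pos (by linarith),
    div_lt_one (by linarith)]
  linarith

theorem two_mul_sepRadius_sq {v : ℝ} (hv : 1 / 2 < v) :
    2 * v * sepRadius v ^ 2 = 2 * v + -1 / (2 * v) := by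
  have : v ≠ 0 := by linarith
  rw [sepRadius_sq hv]; field_simp; ring

/-- `(2vR)² = 4v² - 1` is below `3` because `v < 1`. This gives the rotation on the separatrix a
fixed direction. -/
theorem four_mul_sepRadius_lt {v : ℝ} (hv : 1 / 2 < v) (hv1 : v < 1) :
    4 * v * sepRadius v < 2 * √3 := by
  have h : (2 * v * sepRadius v) ^ 2 < 3 := by
    have h1 := two_mul_sepRadius_sq hv
    have h2 : (2 * v * sepRadius v) ^ 2 = 4 * v ^ 2 - 1 := by
      have : v ≠ 0 := by linarith
      calc _ = 2 * v * (2 * v * sepRadius v ^ 2) := by ring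
        _ = _ := by rw [h1]; field_simp; ring
    nlinarith
  have := Real.lt_sqrt_of_sq_lt h
  linarith

/-- `z` is nondecreasing and bounded; a limit below `R` would keep the derivative above a positive
constant. -/
theorem tendsto_of_logistic {z z' : ℝ → ℝ} {R δ : ℝ} (hδ : 0 < δ) (hR : 0 < R)
    (hz : ∀ t, HasDerivAt z (z' t) t) (h : ∀ t, δ * (R ^ 2 - z t ^ 2) ≤ z' t)
    (hb : ∀ t, z t ^ 2 < R ^ 2) : Tendsto z atTop (𝓝 R) := by
  have hz' : ∀ t, 0 ≤ z' t := fun t =>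
    (mul_pos hδ (sub_pos.2 (hb t))).le.trans (h t)
  have hlt : ∀ t, |z t| < R := fun t => abs_lt_of_sq_lt_sq (hb t) hR.le
  have hm := monotoneOn_Ici_of_hasDerivAt (T := 0) hz fun t _ => hz' t
  obtain ⟨l, hl⟩ := exists_tendsto_of_monotoneOn hm fun t _ => (abs_lt.1 (hlt t)).2.le
  have hlR : l ≤ R := le_of_tendsto hl (Eventually.of_forall fun t => (abs_lt.1 (hlt t)).2.le)
  have hl0 : z 0 ≤ l := ge_of_tendsto hl (by
    filter_upwards [eventually_ge_atTop 0] with t ht using hm self_mem_Ici ht ht)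
  have hlR' := (abs_lt.1 (hlt 0)).1
  rcases hlR.eq_or_lt with rfl | hlt'
  · exact hl
  · exfalso
    have hpos : 0 < δ * (R ^ 2 - l ^ 2) := mul_pos hδ (by nlinarith)
    have hlim : Tendsto (fun t => δ * (R ^ 2 - z t ^ 2)) atTop (𝓝 (δ * (R ^ 2 - l ^ 2))) :=
      ((hl.pow 2).const_sub _).const_mul _
    obtain ⟨T, hT⟩ := eventually_atTop.1 (hlim.eventually_const_le (half_lt_self hpos))
    exact not_tendsto_nhds_of_tendsto_atTop (tendsto_atTop_of_le_hasDerivAt (half_pos hpos) hz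
      fun t ht => (hT t ht).trans (h t)) l hl

/-- On the semicircle `y² + a² = R²`, `y' = a² (2√3 + 4vy)` is bounded below by a positive multiple
of `R² - y²`, so `y` tends to `R`. The past limit follows since `-y(-t)` satisfies the same
inequality. -/
theorem exists_typeII2_orbit {v : ℝ} (hv : 1 / 2 < v) (hv1 : v < 1) :
    ∃ γ : ℝ → State, IsSolution v γ ∧ (∀ t, γ t 0 = -1 / (2 * v)) ∧ (∀ t, 0 < γ t 2) ∧
      (∀ t, γ t 3 = 0) ∧ (∀ t, γ t 1 ^ 2 + γ t 2 ^ 2 = sepRadius v ^ 2) ∧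
      Tendsto (fun t => γ t 1) atTop (𝓝 (sepRadius v)) ∧
      Tendsto (fun t => γ t 1) atBot (𝓝 (-sepRadius v)) := by
  have hR := sepRadius_pos hv
  have hRsq := sepRadius_sq hv
  set R := sepRadius v with hRdef
  have hδ : 0 < 2 * √3 - 4 * v * R := sub_pos.2 (four_mul_sepRadius_lt hv hv1)
  obtain ⟨γ, hγ, h0⟩ := exists_solution (v := v) ⟨by linarith, hv1⟩
    (p := ![-1 / (2 * v), 0, R, 0]) (by
      simp only [constraint, sigSq, sigP, sigM, n2, n3, Matrix.cons_val]
      linarith)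
  have h := hγ.constrainedSolution (by
      rw [h0]
      simp only [constraint, sigSq, sigP, sigM, n2, n3, Matrix.cons_val]
      linarith)
  have hx : ∀ t, γ t 0 = -1 / (2 * v) := h.x_eq_of_eq (by linarith) (by simp [h0])
  have ha : ∀ t, 0 < γ t 2 := h.a_pos (by simpa [h0] using hR)
  have hb : ∀ t, γ t 3 = 0 := h.b_eq_zero (by simp [h0])
  have hsph : ∀ t, γ t 1 ^ 2 + γ t 2 ^ 2 = R ^ 2 := fun t => by
    have := h.sphere t
    simp only [hx, hb, sub_zero] at this
    linarith
  have hy2 : ∀ t, γ t 1 ^ 2 < R ^ 2 := fun t => by nlinarith [hsph t, ha t]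
  have hd : ∀ t, HasDerivAt (fun t => γ t 1) (γ t 2 ^ 2 * (2 * √3 + 4 * v * γ t 1)) t := fun t =>
    (h.hasDerivAt_y t).congr_deriv (by simp only [hb]; ring)
  have hle : ∀ t, (2 * √3 - 4 * v * R) * (R ^ 2 - γ t 1 ^ 2) ≤
      γ t 2 ^ 2 * (2 * √3 + 4 * v * γ t 1) := fun t => by
    have h1 := (abs_lt.1 (abs_lt_of_sq_lt_sq (hy2 t) hR.le)).1
    have h2 : R ^ 2 - γ t 1 ^ 2 = γ t 2 ^ 2 := by linarith [hsph t]
    rw [h2, mul_comm]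
    refine mul_le_mul_of_nonneg_left ?_ (sq_nonneg _)
    nlinarith
  refine ⟨γ, hγ, hx, ha, hb, hsph, tendsto_of_logistic hδ hR hd hle hy2, ?_⟩
  have hrev := tendsto_of_logistic (z := fun t => -γ (-t) 1) hδ hR
    (fun t => ((hd (-t)).scomp t (hasDerivAt_neg t)).neg) (fun t => by
      simpa using hle (-t)) (fun t => by simpa using hy2 (-t))
  simpa [Function.comp_def] using (hrev.comp tendsto_neg_atBot_atTop).neg

/-- The reflection which exchanges `N₂` and `N₃`. -/
def reflectState (p : State) : State := ![p 0, -p 1, p 3, p 2]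

theorem continuous_reflectState : Continuous reflectState := by
  refine continuous_pi fun i => ?_
  fin_cases i <;> simp [reflectState] <;> fun_prop

theorem IsSolution.reflectState {v : ℝ} {γ : ℝ → State} (hγ : IsSolution v γ) :
    IsSolution v fun t => reflectState (γ t) := fun t => by
  obtain ⟨h0, h1, h2, h3⟩ := hasDerivAt_state_iff.1 (hγ t)
  refine hasDerivAt_state_iff.2 ⟨h0.congr_deriv ?_, h1.neg.congr_deriv ?_, h3.congr_deriv ?_,
    h2.congr_deriv ?_⟩
  all_goals
    simp only [vectorField, LambdaR.reflectState, sigSq, sig2, sig3, sigP, sigM, n2, n3,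
      Matrix.cons_val]
    ring

theorem vectorField_eq_zero_of_mem_kasnerCircle {v : ℝ} {p : State} (hp : p ∈ kasnerCircle) :
    vectorField v p = 0 := by
  obtain ⟨h1, h2, h3⟩ := hp
  ext i
  fin_cases i <;> simp [vectorField, h1, h2, h3]

theorem isPeriodTwoHeteroclinicCycle_separatrixBoundary {v : ℝ} (hv : 1 / 2 < v) (hv1 : v < 1) :
    IsPeriodTwoHeteroclinicCycle v (separatrixBoundary v) := by
  obtain ⟨γ, hγ, hx, ha, hb, hsph, htop, hbot⟩ := exists_typeII2_orbit hv hv1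
  have hR := sepRadius_pos hv
  have hRsq := sepRadius_sq hv
  set R := sepRadius v with hRdef
  have hcon : ∀ t, constraint (γ t) = 0 := fun t => by
    simp only [constraint, sigSq, sigP, sigM, n2, n3, hx, hb]
    linarith [hsph t]
  have hlim : ∀ {l : Filter ℝ} {Y : ℝ}, Tendsto (fun t => γ t 1) l (𝓝 Y) → Y ^ 2 = R ^ 2 →
      Tendsto γ l (𝓝 ![-1 / (2 * v), Y, 0, 0]) := fun {l Y} hY hYR => by
    have ha0 : Tendsto (fun t => γ t 2) l (𝓝 0) := by
      have := ((hY.pow 2).const_sub (R ^ 2)).sqrt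
      rw [hYR, sub_self, Real.sqrt_zero] at this
      refine this.congr fun t => ?_
      rw [← Real.sqrt_sq (ha t).le]
      congr 1
      linarith [hsph t]
    rw [tendsto_pi_nhds]
    intro i
    fin_cases i
    · simp [hx, tendsto_const_nhds]
    · exact hY
    · exact ha0
    · simp [hb, tendsto_const_nhds]
  have hkas : ∀ Y : ℝ, Y ^ 2 = R ^ 2 → (![-1 / (2 * v), Y, 0, 0] : State) ∈ kasnerCircle :=
    fun Y hY => ⟨by
      simp only [sigSq, sigP, sigM, Matrix.cons_val_zero, Matrix.cons_val_one]
      linarith, rfl, rfl⟩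
  have hrefl : ∀ Y : ℝ, reflectState ![-1 / (2 * v), Y, 0, 0] = ![-1 / (2 * v), -Y, 0, 0] :=
    fun Y => by simp [reflectState]
  -- Every value of `Σ₋` strictly between the limits is attained, and `Σ₋` determines the point on
  -- the semicircle; so one orbit fills it.
  have hsurj : ∀ r : ℝ, r ^ 2 < R ^ 2 → ∃ t, γ t 1 = r := fun r hr => by
    have hr' := abs_lt.1 (abs_lt_of_sq_lt_sq hr hR.le)
    have hc : Continuous fun t => γ t 1 :=
      continuous_iff_continuousAt.2 fun t => (hasDerivAt_state_iff.1 (hγ t)).2.1.continuousAt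
    exact mem_range_of_exists_le_of_exists_ge hc
      ((hbot.eventually_le_const hr'.1).exists) ((htop.eventually_const_le hr'.2).exists)
  have hneg : (-R) ^ 2 = R ^ 2 := neg_sq R
  have hkp := hkas (-R) hneg
  have hkq := hkas R rfl
  refine ⟨_, _, γ, fun t => reflectState (γ t), hkp, hkq, fun hc => ?_,
    vectorField_eq_zero_of_mem_kasnerCircle hkp, vectorField_eq_zero_of_mem_kasnerCircle hkq,
    hγ, fun t => ⟨hcon t, ha t, hb t⟩, hlim hbot hneg, hlim htop rfl, hγ.reflectState,
    fun t => ⟨?_, hb t, ha t⟩, ?_, ?_, ?_⟩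
  · have : -R = R := congrFun hc 1
    linarith
  · have := hcon t
    simp only [constraint, sigSq, sigP, sigM, n2, n3, reflectState, Matrix.cons_val] at this ⊢
    linarith
  · have := (continuous_reflectState.tendsto _).comp (hlim hbot hneg)
    rwa [hrefl, neg_neg] at this
  · have := (continuous_reflectState.tendsto _).comp (hlim htop rfl)
    rwa [hrefl] at this
  · ext z
    constructor
    · rintro ⟨(⟨hz, hz2, hz3⟩ | ⟨hz, hz2, hz3⟩) | ⟨hz, hz2, hz3⟩, hz0⟩
      · simp only [constraint, sigSq, sigP, sigM, n2, n3] at hz hz2 hz3 hz0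
        rw [hz0, hz3] at hz
        obtain ⟨t, ht⟩ := hsurj (z 1) (by nlinarith)
        refine Or.inl (Or.inr ⟨t, ?_⟩)
        ext i
        fin_cases i
        · exact (hx t).trans hz0.symm
        · exact ht
        · refine (pow_left_inj₀ (ha t).le hz2.le two_ne_zero).1 ?_
          have := hsph t
          rw [ht] at this
          linarith
        · exact (hb t).trans hz3.symm
      · simp only [constraint, sigSq, sigP, sigM, n2, n3] at hz hz2 hz3 hz0
        rw [hz0, hz2] at hz
        obtain ⟨t, ht⟩ := hsurj (-z 1) (by nlinarith)
        refine Or.inr ⟨t, ?_⟩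
        ext i
        fin_cases i
        · exact (hx t).trans hz0.symm
        · exact neg_eq_iff_eq_neg.2 ht
        · exact (hb t).trans hz2.symm
        · refine (pow_left_inj₀ (ha t).le hz3.le two_ne_zero).1 ?_
          have := hsph t
          rw [ht] at this
          linarith
      · simp only [sigSq, sigP, sigM, n2, n3] at hz hz2 hz3 hz0
        rw [hz0] at hz
        have h1 : z 1 ^ 2 = R ^ 2 := by linarith
        refine Or.inl (Or.inl ?_)
        rcases sq_eq_sq_iff_eq_or_eq_neg.1 h1 with h | h
        · right
          ext i
          fin_cases i
          exacts [hz0, h, hz2, hz3]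
        · left
          ext i
          fin_cases i
          exacts [hz0, h, hz2, hz3]
    · rintro (((rfl | rfl) | ⟨t, rfl⟩) | ⟨t, rfl⟩)
      · exact ⟨Or.inr hkp, rfl⟩
      · exact ⟨Or.inr hkq, rfl⟩
      · exact ⟨Or.inl (Or.inl ⟨hcon t, ha t, hb t⟩), hx t⟩
      · refine ⟨Or.inl (Or.inr ⟨?_, hb t, ha t⟩), hx t⟩
        have := hcon t
        simp only [constraint, sigSq, sigP, sigM, n2, n3, reflectState, Matrix.cons_val] at this ⊢
        linarith

theorem separatrix_nonempty {v : ℝ} (hv : 1 / 2 < v) : (separatrix v).Nonempty := by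
  have hR := sepRadius_pos hv
  refine ⟨![-1 / (2 * v), 0, 1 + sepRadius v, 1], ⟨?_, ?_, ?_⟩, rfl⟩
  · simp only [constraint, sigSq, sigP, sigM, n2, n3, Matrix.cons_val]
    linarith [sepRadius_sq hv]
  · simp only [n2, Matrix.cons_val]
    linarith
  · simp [n3]

theorem isInvariant_separatrix {v : ℝ} (hv : 1 / 2 < v) : IsInvariant v (separatrix v) := by
  intro γ hγ h0 t
  have h := hγ.constrainedSolution h0.1.1
  refine ⟨⟨?_, h.a_pos h0.1.2.1 t, h.b_pos h0.1.2.2 t⟩, h.x_eq_of_eq (by linarith) h0.2 t⟩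
  have := h.sphere t
  simp only [constraint, sigSq, sigP, sigM, n2, n3]
  linarith

/-- The differentials are dependent only where `Σ₋ = 0` and `N₂ = N₃`; there the constraint gives
`Σ₊² = 1`, impossible for `Σ₊ = -1/(2v)` with `v > 1/2`. -/
theorem isCodimOne_separatrix {v : ℝ} (hv : 1 / 2 < v) : IsCodimOne (separatrix v) := by
  refine ⟨fun p hp => hp.1, fun p hp => ⟨univ, fun q => q 0 - -1 / (2 * v), isOpen_univ,
    mem_univ _, ContDiff.contDiffOn (by fun_prop), ?_, ?_⟩⟩
  · ext q
    simp [separatrix, sigP, sub_eq_zero]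
  · let π : Fin 4 → State →L[ℝ] ℝ := fun i => ContinuousLinearMap.proj i
    have hπ : ∀ i, HasFDerivAt (fun q : State => q i) (π i) p := fun i => (π i).hasFDerivAt
    have hf : HasFDerivAt (fun q : State => q 0 - -1 / (2 * v)) (π 0) p := (hπ 0).sub_const _
    have hc := (((hπ 0).pow 2).add ((hπ 1).pow 2)).const_sub 1 |>.sub
      (((hπ 2).sub (hπ 3)).pow 2)
    have hc' : HasFDerivAt constraint _ p := hc
    rw [hf.fderiv, hc'.fderiv, LinearIndependent.pair_iff]
    intro s t hst
    have e : ∀ w : State, _ := fun w => congrArg (fun L : State →L[ℝ] ℝ => L w) hst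
    have e1 := e ![0, 1, 0, 0]
    have e2 := e ![0, 0, 1, 0]
    have e0 := e ![1, 0, 0, 0]
    simp [π] at e0 e1 e2
    have hs : s = 0 := by
      by_contra hs
      have h1 : p 1 = 0 := by tauto
      have h2 : p 2 - p 3 = 0 := by tauto
      have h3 := hp.1.1
      have h4 := hp.2
      simp only [constraint, sigSq, sigP, sigM, n2, n3] at h3 h4
      rw [h1, h2, h4] at h3
      have := sepRadius_sq hv
      nlinarith [sepRadius_pos hv]
    rw [hs] at e0
    exact ⟨hs, by simpa using e0⟩

/-! ### Winding of the orbits in the separatrix -/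

theorem exists_angle {y c R : ℝ} (hR : 0 < R) (h : y ^ 2 + c ^ 2 = R ^ 2) :
    ∃ θ : ℝ, y = R * Real.sin θ ∧ c = R * Real.cos θ := by
  have hn : ‖(⟨c, y⟩ : ℂ)‖ = R := by
    rw [Complex.norm_def, Complex.normSq_mk, ← Real.sqrt_sq hR.le]
    congr 1; linarith
  refine ⟨Complex.arg ⟨c, y⟩, ?_, ?_⟩
  · rw [← hn, Complex.norm_mul_sin_arg]
  · rw [← hn, Complex.norm_mul_cos_arg]

namespace ConstrainedSolution

variable {v : ℝ} {x y a b : ℝ → ℝ}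

theorem separatrix_sphere (h : ConstrainedSolution v x y a b) (hv : 1 / 2 < v)
    (hx : ∀ t, x t = -1 / (2 * v)) (t : ℝ) : y t ^ 2 + (a t - b t) ^ 2 = sepRadius v ^ 2 := by
  have := h.sphere t
  rw [hx] at this
  linarith [sepRadius_sq hv]

theorem abs_y_le_sepRadius (h : ConstrainedSolution v x y a b) (hv : 1 / 2 < v)
    (hx : ∀ t, x t = -1 / (2 * v)) (t : ℝ) : |y t| ≤ sepRadius v :=
  abs_le_of_sq_le_sq (by nlinarith [h.separatrix_sphere hv hx t, sq_nonneg (a t - b t)])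
    (sepRadius_pos hv).le

theorem separatrix_two_mul (h : ConstrainedSolution v x y a b) (hv : 1 / 2 < v)
    (hx : ∀ t, x t = -1 / (2 * v)) (t : ℝ) :
    2 * v * (1 - (a t - b t) ^ 2) + x t = 2 * v * y t ^ 2 := by
  rw [hx]
  linear_combination -(2 * v) * h.separatrix_sphere hv hx t - two_mul_sepRadius_sq hv

/-- The derivative `-8v y²` of `log(ab)` vanishes where `y = 0`; adding the bounded correction `w =
yc/s` makes the decay uniform. -/
theorem separatrix_tendsto_mul (h : ConstrainedSolution v x y a b) (hv : 1 / 2 < v) (hv1 : v < 1)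
    (ha : ∀ t, 0 < a t) (hb : ∀ t, 0 < b t) (hx : ∀ t, x t = -1 / (2 * v)) :
    Tendsto (fun t => a t * b t) atTop (𝓝 0) := by
  have hR := sepRadius_pos hv
  have hδ := sub_pos.2 (four_mul_sepRadius_lt hv hv1)
  have hv0 : 0 < v := by linarith
  have hP : ∀ t, HasDerivAt (fun t => Real.log (a t * b t)) (-8 * v * y t ^ 2) t := fun t => by
    have hne := (mul_pos (ha t) (hb t)).ne'
    refine ((h.hasDerivAt_mul t).log hne).congr_deriv ?_
    rw [h.separatrix_two_mul hv hx, div_eq_iff hne]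
    ring
  -- Using `ab/s² ≤ 1/4`, the derivative of `w - (√3/v) log(ab)` is at least `(2√3 - 4vR) c² + 6√3
  -- y²`, hence at least `(2√3 - 4vR) R²`.
  have hT := tendsto_atTop_of_le_hasDerivAt (T := 0)
    (mul_pos hδ (pow_pos hR 2)) (fun t => (h.hasDerivAt_mul_div ha hb t).sub
      ((hP t).const_mul (√3 / v))) fun t _ => by
    have hw := (abs_le.1 ((abs_mul_div_le ha hb t).trans (h.abs_y_le_sepRadius hv hx t))).1
    have hg := mul_div_sq_le ha hb t
    have hs := h.separatrix_sphere hv hx t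
    generalize y t * (a t - b t) / (a t + b t) = w at *
    generalize a t * b t / (a t + b t) ^ 2 = g at *
    have h1 : √3 / v * (-8 * v * y t ^ 2) = -8 * √3 * y t ^ 2 := by field_simp
    have h2 : (a t - b t) ^ 2 = sepRadius v ^ 2 - y t ^ 2 := by linarith
    have h3 : 0 < √3 := by positivity
    have h4 : -(4 * v * (a t - b t) ^ 2 * sepRadius v) ≤ 4 * v * (a t - b t) ^ 2 * w := by
      have := mul_le_mul_of_nonneg_left hw (by positivity : 0 ≤ 4 * v * (a t - b t) ^ 2)
      linarith
    have h5 : √3 * y t ^ 2 * g ≤ √3 * y t ^ 2 * (1 / 4) :=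
      mul_le_mul_of_nonneg_left hg (by positivity)
    rw [h1]
    rw [h2] at h4 ⊢
    nlinarith [mul_nonneg (mul_nonneg hv0.le hR.le) (sq_nonneg (y t)),
      mul_nonneg h3.le (sq_nonneg (y t))]
  have hlog : Tendsto (fun t => Real.log (a t * b t)) atTop atBot := by
    have h3 : 0 < √3 / v := by positivity
    have h1 : Tendsto (fun t => -(√3 / v * Real.log (a t * b t))) atTop atTop := by
      refine tendsto_atTop_mono (fun t => ?_) (tendsto_atTop_add_const_left _ (-1) hT)
      have := (abs_le.1 ((abs_mul_div_le ha hb t).trans (h.abs_y_le t))).2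
      simp only [Pi.sub_apply]
      linarith
    have h2 := (tendsto_neg_atTop_atBot.comp h1).const_mul_atBot (inv_pos.2 h3)
    refine h2.congr fun t => ?_
    simp only [Function.comp_apply, neg_neg]
    field_simp
  exact (Real.tendsto_exp_atBot.comp hlog).congr fun t =>
    Real.exp_log (mul_pos (ha t) (hb t))

/-- An angular variable in the `(Σ₋, N₂ - N₃)`-plane tends to infinity. -/
theorem separatrix_exists_angle (h : ConstrainedSolution v x y a b) (hv : 1 / 2 < v) (hv1 : v < 1)
    (ha : ∀ t, 0 < a t) (hb : ∀ t, 0 < b t) (hx : ∀ t, x t = -1 / (2 * v)) :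
    ∃ θ : ℝ → ℝ, Continuous θ ∧ Tendsto θ atTop atTop ∧
      ∀ t, y t = sepRadius v * Real.sin (θ t) ∧ a t - b t = sepRadius v * Real.cos (θ t) := by
  have hR := sepRadius_pos hv
  have hδ := sub_pos.2 (four_mul_sepRadius_lt hv hv1)
  have hv0 : 0 < v := by linarith
  have hya := h.continuous_y
  have hca := h.continuous_a
  have hcb := h.continuous_b
  obtain ⟨θ₀, hy0, hc0⟩ := exists_angle hR (h.separatrix_sphere hv hx 0)
  obtain ⟨F, hF0, hF⟩ := exists_primitive
    (f := fun t => 4 * v * y t * (a t - b t) + 2 * √3 * (a t + b t)) (by fun_prop)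
  have hθ : ∀ t, HasDerivAt (fun t => θ₀ + F t)
      (4 * v * y t * (a t - b t) + 2 * √3 * (a t + b t)) t := fun t => (hF t).const_add _
  have hc : ∀ t, HasDerivAt (fun t => a t - b t)
      (-y t * (4 * v * y t * (a t - b t) + 2 * √3 * (a t + b t))) t := fun t =>
    ((h.hasDerivAt_a t).sub (h.hasDerivAt_b t)).congr_deriv (by
      linear_combination (-2 * (a t - b t)) * h.separatrix_two_mul hv hx t)
  have hconst : ∀ {f : ℝ → ℝ}, (∀ t, HasDerivAt f 0 t) → ∀ t, f t = f 0 := fun hf t =>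
    is_const_of_deriv_eq_zero (fun t => (hf t).differentiableAt) (fun t => (hf t).deriv) t 0
  have hsc := fun t => Real.sin_sq_add_cos_sq (θ₀ + F t)
  -- In the frame rotating with the angle, `(y, c)` has constant coordinates; their initial values
  -- are `R` and `0`.
  have h1 := hconst fun t => (((h.hasDerivAt_y t).mul (hθ t).sin).add
    ((hc t).mul (hθ t).cos)).congr_deriv (by ring)
  have h2 := hconst fun t => (((h.hasDerivAt_y t).mul (hθ t).cos).sub
    ((hc t).mul (hθ t).sin)).congr_deriv (by ring)
  simp only [Pi.add_apply, Pi.sub_apply, Pi.mul_apply, hF0, add_zero, hy0, hc0] at h1 h2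
  have hy : ∀ t, y t = sepRadius v * Real.sin (θ₀ + F t) := fun t => by
    linear_combination Real.sin (θ₀ + F t) * h1 t + Real.cos (θ₀ + F t) * h2 t - y t * hsc t
      + sepRadius v * Real.sin (θ₀ + F t) * Real.sin_sq_add_cos_sq θ₀
  have hcos : ∀ t, a t - b t = sepRadius v * Real.cos (θ₀ + F t) := fun t => by
    linear_combination Real.cos (θ₀ + F t) * h1 t - Real.sin (θ₀ + F t) * h2 t
      - (a t - b t) * hsc t + sepRadius v * Real.cos (θ₀ + F t) * Real.sin_sq_add_cos_sq θ₀
  have hcont : Continuous fun t => θ₀ + F t :=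
    continuous_iff_continuousAt.2 fun t => (hθ t).continuousAt
  have hs : ∀ t, 0 < a t + b t := fun t => add_pos (ha t) (hb t)
  have hrate : ∀ t, (2 * √3 - 4 * v * sepRadius v) * (a t + b t) ≤
      4 * v * y t * (a t - b t) + 2 * √3 * (a t + b t) := fun t => by
    have := mul_le_mul (h.abs_y_le_sepRadius hv hx t) (abs_sub_le_add (ha t) (hb t))
      (abs_nonneg _) hR.le
    rw [← abs_mul] at this
    nlinarith [(abs_le.1 this).1]
  refine ⟨fun t => θ₀ + F t, hcont, ?_, fun t => ⟨hy t, hcos t⟩⟩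
  have hm := monotoneOn_Ici_of_hasDerivAt (T := 0) hθ fun t _ =>
    (mul_pos hδ (hs t)).le.trans (hrate t)
  by_cases hbd : ∃ B, ∀ t, 0 ≤ t → θ₀ + F t ≤ B
  · exfalso
    obtain ⟨B, hB⟩ := hbd
    obtain ⟨l, hl⟩ := exists_tendsto_of_monotoneOn hm hB
    have hY : Tendsto y atTop (𝓝 (sepRadius v * Real.sin l)) :=
      (((Real.continuous_sin.tendsto l).comp hl).const_mul _).congr fun t => (hy t).symm
    have hC : Tendsto (fun t => a t - b t) atTop (𝓝 (sepRadius v * Real.cos l)) :=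
      (((Real.continuous_cos.tendsto l).comp hl).const_mul _).congr fun t => (hcos t).symm
    have hS : Tendsto (fun t => a t + b t) atTop (𝓝 √((sepRadius v * Real.cos l) ^ 2 + 4 * 0)) :=
      ((hC.pow 2).add ((h.separatrix_tendsto_mul hv hv1 ha hb hx).const_mul 4)).sqrt.congr
        fun t => by
          rw [← Real.sqrt_sq (hs t).le]
          congr 1; ring
    rw [mul_zero, add_zero, Real.sqrt_sq_eq_abs] at hS
    -- As `ab → 0`, `s` tends to the limit of `|c|`; were it positive, the angle would grow without
    -- bound.
    have hC0 : |sepRadius v * Real.cos l| = 0 := by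
      by_contra hne
      have hpos := mul_pos hδ (lt_of_le_of_ne (abs_nonneg _) (Ne.symm hne))
      obtain ⟨T, hT⟩ := eventually_atTop.1
        ((hS.const_mul _).eventually_const_le (half_lt_self hpos))
      exact not_tendsto_nhds_of_tendsto_atTop (tendsto_atTop_of_le_hasDerivAt (half_pos hpos) hθ
        fun t ht => (hT t ht).trans (hrate t)) l hl
    rw [hC0] at hS
    have ha0 : Tendsto a atTop (𝓝 0) := squeeze_zero (fun t => (ha t).le)
      (fun t => by linarith [hb t]) hS
    have hb0 : Tendsto b atTop (𝓝 0) := squeeze_zero (fun t => (hb t).le)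
      (fun t => by linarith [ha t]) hS
    have hX : Tendsto x atTop (𝓝 (-1 / (2 * v))) := by
      simp only [funext hx, tendsto_const_nhds]
    have e1 := h.neg_two_mul_le_of_tendsto ha hX hY ha0 hb0
    have e2 := h.reflect.neg_two_mul_le_of_tendsto hb hX hY.neg hb0 ha0
    have hYR : (sepRadius v * Real.sin l) ^ 2 = sepRadius v ^ 2 := by
      have := abs_eq_zero.1 hC0
      have h4 : (sepRadius v * Real.cos l) ^ 2 = 0 := by rw [this]; ring
      linear_combination sepRadius v ^ 2 * Real.sin_sq_add_cos_sq l - h4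
    -- The limit is now a Kasner point with `Σ₋ = ±R`, and this inequality makes `N₂` or `N₃` grow
    -- near it.
    have hlt : 2 * v * sepRadius v ^ 2 < √3 * sepRadius v := by
      nlinarith
    have h5 := two_mul_sepRadius_sq hv
    rcases sq_eq_sq_iff_eq_or_eq_neg.1 hYR with h6 | h6
    · rw [h6] at e2; linarith
    · rw [h6] at e1; linarith
  · push Not at hbd
    refine tendsto_atTop.2 fun B => ?_
    obtain ⟨T, hT, hTB⟩ := hbd B
    filter_upwards [eventually_ge_atTop T] with t ht
    exact hTB.le.trans (hm hT (hT.trans ht) ht)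

end ConstrainedSolution

/-- The type `VII₀` orbits in the separatrix spiral out to the heteroclinic cycle. -/
theorem omegaLimitSet_eq_separatrixBoundary {v : ℝ} (hv : 1 / 2 < v) (hv1 : v < 1)
    {γ : ℝ → State} (hγ : IsSolution v γ) (h0 : γ 0 ∈ separatrix v) :
    omegaLimitSet γ = separatrixBoundary v := by
  have h := hγ.constrainedSolution h0.1.1
  have ha := h.a_pos h0.1.2.1
  have hb := h.b_pos h0.1.2.2
  have hx : ∀ t, γ t 0 = -1 / (2 * v) := h.x_eq_of_eq (by linarith) h0.2
  have hP := h.separatrix_tendsto_mul hv hv1 ha hb hx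
  obtain ⟨θ, hθc, hθ, hang⟩ := h.separatrix_exists_angle hv hv1 ha hb hx
  have hR := sepRadius_pos hv
  ext z
  rw [mem_omegaLimitSet_iff]
  constructor
  · intro hz
    have hlim : ∀ {f : State → ℝ} {L : ℝ}, Continuous f →
        Tendsto (fun t => f (γ t)) atTop (𝓝 L) → f z = L := fun hf hL =>
      (hz.continuousAt_comp hf.continuousAt).eq_of_tendsto hL
    have hz0 : z 0 = -1 / (2 * v) := hlim (f := fun q => q 0) (by fun_prop)
      (by simp only [hx, tendsto_const_nhds])
    have hzP : z 2 * z 3 = 0 := hlim (f := fun q => q 2 * q 3) (by fun_prop) hP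
    have hzc : z 0 ^ 2 + z 1 ^ 2 + (z 2 - z 3) ^ 2 = 1 :=
      hlim (f := fun q => q 0 ^ 2 + q 1 ^ 2 + (q 2 - q 3) ^ 2) (by fun_prop)
        (by simp only [h.sphere, tendsto_const_nhds])
    have hnn : ∀ i : Fin 4, (∀ t, 0 < γ t i) → 0 ≤ z i := fun i hi => by
      by_contra! hlt
      obtain ⟨t, ht⟩ := (hz.frequently (p := fun q => q i < 0)
        ((continuous_apply i).tendsto z |>.eventually_lt_const hlt)).exists
      exact absurd ht (hi t).le.not_gt
    have hz2 := hnn 2 ha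
    have hz3 := hnn 3 hb
    refine ⟨?_, hz0⟩
    rcases hz2.eq_or_lt with e2 | e2 <;> rcases hz3.eq_or_lt with e3 | e3
    · refine Or.inr ⟨?_, e2.symm, e3.symm⟩
      rw [← e2, ← e3] at hzc
      simp only [sigSq, sigP, sigM]
      linarith
    · refine Or.inl (Or.inr ⟨?_, e2.symm, e3⟩)
      simp only [constraint, sigSq, sigP, sigM, n2, n3]
      linarith
    · refine Or.inl (Or.inl ⟨?_, e2, e3.symm⟩)
      simp only [constraint, sigSq, sigP, sigM, n2, n3]
      linarith
    · exact absurd hzP (mul_pos e2 e3).ne'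
  · intro hz
    have hz0 : z 0 = -1 / (2 * v) := hz.2
    obtain ⟨hz2, hz3, hzP, hzc⟩ : 0 ≤ z 2 ∧ 0 ≤ z 3 ∧ z 2 * z 3 = 0 ∧
        z 0 ^ 2 + z 1 ^ 2 + (z 2 - z 3) ^ 2 = 1 := by
      rcases hz.1 with (⟨h1, h2, h3⟩ | ⟨h1, h2, h3⟩) | ⟨h1, h2, h3⟩ <;>
        simp only [constraint, sigSq, sigP, sigM, n2, n3] at h1 h2 h3
      · exact ⟨h2.le, h3.ge, by rw [h3, mul_zero], by linarith⟩
      · exact ⟨h2.ge, h3.le, by rw [h2, zero_mul], by linarith⟩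
      · exact ⟨h2.ge, h3.ge, by rw [h3, mul_zero], by rw [h2, h3]; linarith⟩
    obtain ⟨φ, hφs, hφc⟩ := exists_angle (y := z 1) (c := z 2 - z 3) hR (by
      rw [hz0] at hzc
      linarith [sepRadius_sq hv])
    -- By continuity the angle passes through `φ` modulo `2π` at arbitrarily late times, where `Σ₋`
    -- and `N₂ - N₃` agree exactly with those of `z`.
    have hhit : ∀ n : ℕ, ∃ t, (n : ℝ) ≤ t ∧ ∃ k : ℕ, θ t = φ + k * (2 * Real.pi) := fun n => by
      have hk : Tendsto (fun k : ℕ => φ + k * (2 * Real.pi)) atTop atTop :=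
        tendsto_atTop_add_const_left _ _
          (tendsto_natCast_atTop_atTop.atTop_mul_const Real.two_pi_pos)
      obtain ⟨k, hk⟩ := (hk.eventually_ge_atTop (θ n)).exists
      obtain ⟨T, hT, hnT⟩ := ((hθ.eventually_ge_atTop (φ + k * (2 * Real.pi))).and
        (eventually_ge_atTop (n : ℝ))).exists
      obtain ⟨t, ht, hteq⟩ := intermediate_value_Icc hnT hθc.continuousOn ⟨hk, hT⟩
      exact ⟨t, ht.1, k, hteq⟩
    choose τ hτ k hk using hhit
    have hτ' : Tendsto τ atTop atTop :=
      tendsto_atTop_mono hτ tendsto_natCast_atTop_atTop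
    have hy : ∀ n, γ (τ n) 1 = z 1 := fun n => by
      have := (hang (τ n)).1
      rw [this, hk, Real.sin_add_nat_mul_two_pi, hφs]
    have hc : ∀ n, γ (τ n) 2 - γ (τ n) 3 = z 2 - z 3 := fun n => by
      have := (hang (τ n)).2
      rw [this, hk, Real.cos_add_nat_mul_two_pi, hφc]
    -- At these times `s² = c² + 4ab` tends to `(z 2 - z 3)²`, which equals `(z 2 + z 3)²` since `z
    -- 2 * z 3 = 0`.
    have hs : Tendsto (fun n => γ (τ n) 2 + γ (τ n) 3) atTop (𝓝 (z 2 + z 3)) := by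
      have := (((hP.comp hτ').const_mul 4).const_add ((z 2 - z 3) ^ 2)).sqrt
      have e : √((z 2 - z 3) ^ 2 + 4 * 0) = z 2 + z 3 := by
        rw [← Real.sqrt_sq (add_nonneg hz2 hz3), ← hzP]
        congr 1; ring
      rw [e] at this
      refine this.congr fun n => ?_
      rw [← Real.sqrt_sq (add_pos (ha (τ n)) (hb (τ n))).le]
      congr 1
      simp only [Function.comp_apply, ← hc n]
      ring
    refine MapClusterPt.of_comp hτ' (Tendsto.mapClusterPt ?_)
    rw [tendsto_pi_nhds]
    intro i
    fin_cases i
    · simp [hx, hz0]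
    · simp [hy]
    · have := (hs.add_const (z 2 - z 3)).div_const 2
      rw [show (z 2 + z 3 + (z 2 - z 3)) / 2 = z 2 by ring] at this
      refine this.congr fun n => ?_
      rw [← hc n]
      simp
    · have := (hs.sub_const (z 2 - z 3)).div_const 2
      rw [show (z 2 + z 3 - (z 2 - z 3)) / 2 = z 3 by ring] at this
      refine this.congr fun n => ?_
      rw [← hc n]
      simp

/-! ### The locally rotationally symmetric set -/

/-- The solution in `LRS⁻` with `N₂ = N₃ = N` at time zero. -/
def lrsSolution (v N t : ℝ) : State :=
  ![-1, 0, N * Real.exp (2 * (1 - 2 * v) * t), N * Real.exp (2 * (1 - 2 * v) * t)]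

theorem isSolution_lrsSolution (v N : ℝ) : IsSolution v (lrsSolution v N) := fun t => by
  have hd : HasDerivAt (fun t => N * Real.exp (2 * (1 - 2 * v) * t))
      (N * (Real.exp (2 * (1 - 2 * v) * t) * (2 * (1 - 2 * v) * 1))) t :=
    ((((hasDerivAt_id t).const_mul (2 * (1 - 2 * v))).exp).const_mul N)
  refine hasDerivAt_state_iff.2 ⟨?_, ?_, ?_, ?_⟩
  · exact (hasDerivAt_const t (-1 : ℝ)).congr_deriv (by
      simp [vectorField, lrsSolution, sigSq, sigP, sigM])
  · exact (hasDerivAt_const t (0 : ℝ)).congr_deriv (by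
      simp [vectorField, lrsSolution, sigSq, sigP, sigM, n2, n3])
  · exact hd.congr_deriv (by
      simp only [vectorField, lrsSolution, sigSq, sig2, sigP, sigM, n2, Matrix.cons_val]; ring)
  · exact hd.congr_deriv (by
      simp only [vectorField, lrsSolution, sigSq, sig3, sigP, sigM, n3, Matrix.cons_val]; ring)

theorem IsSolution.eq_lrsSolution {v : ℝ} {γ : ℝ → State} (hγ : IsSolution v γ)
    (h0 : γ 0 ∈ lrsMinus) : γ = lrsSolution v (n2 (γ 0)) := by
  refine hγ.eq (isSolution_lrsSolution v _) ?_
  obtain ⟨h1, h2, h3, -⟩ := h0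
  ext i
  fin_cases i
  · exact h1
  · exact h2
  · simp [lrsSolution, n2]
  · simpa [lrsSolution, n2, n3] using h3.symm

theorem lrsSolution_mem {v N : ℝ} (hN : 0 < N) (t : ℝ) : lrsSolution v N t ∈ lrsMinus :=
  ⟨rfl, rfl, rfl, mul_pos hN (Real.exp_pos _)⟩

theorem tendsto_lrsSolution {v N : ℝ} (hv : v < 1 / 2) (hN : 0 < N) :
    Tendsto (fun t => N * Real.exp (2 * (1 - 2 * v) * t)) atTop atTop :=
  (Real.tendsto_exp_atTop.comp
    (tendsto_id.const_mul_atTop (by linarith : 0 < 2 * (1 - 2 * v)))).const_mul_atTop hN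

theorem range_lrsSolution {v : ℝ} (hv : v < 1 / 2) : range (lrsSolution v 1) = lrsMinus := by
  refine Subset.antisymm (range_subset_iff.2 fun t => lrsSolution_mem one_pos t) fun p hp => ?_
  obtain ⟨h1, h2, h3, h4⟩ := hp
  have hne : 2 * (1 - 2 * v) ≠ 0 := by linarith
  have he : Real.exp (2 * (1 - 2 * v) * (Real.log (n2 p) / (2 * (1 - 2 * v)))) = n2 p := by
    rw [mul_div_cancel₀ _ hne, Real.exp_log h4]
  refine ⟨Real.log (n2 p) / (2 * (1 - 2 * v)), ?_⟩
  unfold lrsSolution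
  rw [he]
  ext i
  fin_cases i
  · exact h1.symm
  · exact h2.symm
  · simp [n2]
  · simpa [n2, n3] using h3

theorem vectorField_eq_zero_of_mem_lrsMinus {p : State} (hp : p ∈ lrsMinus) :
    vectorField (1 / 2) p = 0 := by
  obtain ⟨h1, h2, h3, -⟩ := hp
  ext i
  fin_cases i <;> simp [vectorField, sigSq, sig2, sig3, h1, h2, h3]

end LambdaR

end

theorem mainTheorem8 (v : ℝ) (hv : v ∈ Set.Ioo (0 : ℝ) 1) :
    -- through every point of the state space there is a solution, defined for all times
    (∀ p ∈ LambdaR.typeVII0, ∃ γ : ℝ → LambdaR.State, LambdaR.IsSolution v γ ∧ γ 0 = p) ∧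
    -- all orbits apart from the exceptional ones
    (∀ γ : ℝ → LambdaR.State, LambdaR.IsSolution v γ → γ 0 ∈ LambdaR.typeVII0 →
      (v ≤ 1 / 2 → γ 0 ∉ LambdaR.lrsMinus) →
      (1 / 2 < v → γ 0 ∉ LambdaR.separatrix v) →
      (LambdaR.omegaLimitSet γ).Nonempty ∧
        LambdaR.omegaLimitSet γ ⊆ LambdaR.stableSet v) ∧
    -- subcritical exception
    (v < 1 / 2 →
      (∃ γ : ℝ → LambdaR.State, LambdaR.IsSolution v γ ∧ Set.range γ = LambdaR.lrsMinus) ∧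
      ∀ γ : ℝ → LambdaR.State, LambdaR.IsSolution v γ → γ 0 ∈ LambdaR.lrsMinus →
        (∀ t, γ t ∈ LambdaR.lrsMinus) ∧
        Filter.Tendsto (fun t => LambdaR.n2 (γ t)) Filter.atTop Filter.atTop ∧
        Filter.Tendsto (fun t => LambdaR.n3 (γ t)) Filter.atTop Filter.atTop) ∧
    -- critical exception
    (v = 1 / 2 →
      (∀ p ∈ LambdaR.lrsMinus, LambdaR.vectorField v p = 0) ∧
      ∀ γ : ℝ → LambdaR.State, LambdaR.IsSolution v γ → γ 0 ∈ LambdaR.lrsMinus →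
        ∀ t, γ t = γ 0) ∧
    -- supercritical exception
    (1 / 2 < v →
      (LambdaR.separatrix v).Nonempty ∧
      LambdaR.IsInvariant v (LambdaR.separatrix v) ∧
      LambdaR.IsCodimOne (LambdaR.separatrix v) ∧
      LambdaR.IsPeriodTwoHeteroclinicCycle v (LambdaR.separatrixBoundary v) ∧
      ∀ γ : ℝ → LambdaR.State, LambdaR.IsSolution v γ → γ 0 ∈ LambdaR.separatrix v →
        LambdaR.omegaLimitSet γ = LambdaR.separatrixBoundary v) := by
  have hv' := hv
  obtain ⟨hv0, hv1⟩ := hv'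
  refine ⟨fun p hp => LambdaR.exists_solution hv hp.1,
    fun γ hγ h0 hl hs => LambdaR.omegaLimitSet_nonempty_and_subset hv hγ h0 hl hs,
    fun hlt => ⟨⟨_, LambdaR.isSolution_lrsSolution v 1, LambdaR.range_lrsSolution hlt⟩,
      fun γ hγ h0 => ?_⟩, ?_,
    fun hlt => ⟨LambdaR.separatrix_nonempty hlt, LambdaR.isInvariant_separatrix hlt,
      LambdaR.isCodimOne_separatrix hlt,
      LambdaR.isPeriodTwoHeteroclinicCycle_separatrixBoundary hlt hv1,
      fun γ hγ h0 => LambdaR.omegaLimitSet_eq_separatrixBoundary hlt hv1 hγ h0⟩⟩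
  · rw [hγ.eq_lrsSolution h0]
    exact ⟨LambdaR.lrsSolution_mem h0.2.2.2, LambdaR.tendsto_lrsSolution hlt h0.2.2.2,
      LambdaR.tendsto_lrsSolution hlt h0.2.2.2⟩
  · rintro rfl
    refine ⟨fun p hp => LambdaR.vectorField_eq_zero_of_mem_lrsMinus hp, fun γ hγ h0 t => ?_⟩
    -- The constant curve through a zero of the vector field is a solution; uniqueness identifies
    -- `γ` with it.
    have hconst : LambdaR.IsSolution (1 / 2) fun _ => γ 0 := fun t => by
      rw [LambdaR.vectorField_eq_zero_of_mem_lrsMinus h0]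
      exact hasDerivAt_const t _
    exact congrFun (hγ.eq hconst rfl) t
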